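/- **Setting.** Let $\mathbb T^2=\mathbb R^2/\mathbb Z^2$ with normalized Haar measure $\nu$, let $L^2=L^2(\mathbb T^2,\nu)$ be the space of complex-valued square-integrable functions (real-valued functions are included), and let $L^2_0$ be the orthogonal complement of the constants. Put $T_1=\begin{pmatrix}1&2\\0&1\end{pmatrix}$, $T_2=\begin{pmatrix}1&0\\2&1\end{pmatrix}$ and let $\mathcal G$ be the bounded self-adjoint operator on $L^2$ $$(\mathcal G f)(x)=\tfrac14\big(f(T_1x)+f(T_1^{-1}x)+f(T_2x)+f(T_2^{-1}x)\big),$$ with projection-valued measure $E$. Let $\rho$ be the spectral radius of $\mathcal G|_{L^2_0}$ and $\Sigma_0=[-\rho,\rho]$. Let $a,b,c,\gamma,q,r,\eta$ be real with $b\ne0$, $c\neq 0$, $\gamma>0$, $q\ge 0$, $r>0$; let $k=b^2/r$, let $\Pi>0$ satisfy $2\Pi(a-\gamma/2)-k\Pi^2+q=0$, and let $a_c=a-k\Pi$, $a_\gamma=a_c-\gamma/2$, $\psi=c\Pi-q\eta$, $$\Delta(\lambda)=c^2\lambda^2+4(a_\gamma c+k\psi)\lambda+4a_\gamma^2,\quad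 p(\lambda)=\frac{2a_\gamma+\lambda c+\sqrt{\Delta(\lambda)}}{2k},\quad \mathcal A_{cl}(\lambda)=\tfrac12\big(\gamma+\lambda c-\sqrt{\Delta(\lambda)}\big).$$ Assume that for every $\lambda\in\Sigma_0\cup\{1\}$ the scalar Riccati equation $-kp^2+(2a_c-\gamma+\lambda c)p+\lambda\psi=0$ has a real solution $p$ (equivalently $\Delta(\lambda)\ge 0$). Let $m:[0,\infty)\to L^2$ be a differentiable solution of the closed-loop mean field equation $$\dot m_t=(a_c I+c\,\mathcal G)m_t-k\,S_t,\qquad S_t=p(\mathcal G)m_t ,$$ and let $e_t=m_t-\int m_t\,d\nu\in L^2_0$ be the spatial deviation field. **Theorem.** Assume the Turing-type instability condition: $a_c<0$, $\mathcal A_{cl}(1)<0$, and $\mu_{\max}:=\sup_{\lambda\in\Sigma_0}\mathcal A_{cl}(\lambda)>0$. Let $\lambda^*\in\Sigma_0$ be the dominant spectral mode, that is, the unique point of $\Sigma_0$ with $\mathcal A_{cl}(\lambda^*)=\mu_{\max}$ (uniqueness is assumed). Assume $$\|E((\lambda^*-\epsilon,\lambda^*+\epsilon))e_0\|_{L^2}>0\quad\text{for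 every }\epsilon>0 .$$ Then $e_t\neq 0$ for all $t\ge0$, and the normalized deviation field $\tilde e_t=e_t/\|e_t\|_{L^2}$ satisfies $\lim_{t\to\infty}\langle\tilde e_t,\phi\rangle_{L^2}=0$ for every $\phi\in L^2_0$. In particular no stationary spatial pattern emerges: there is no $f\in L^2$ (eigenfunction or not) with $\tilde e_t\to f$ in the $L^2$-norm. -/

import Mathlib

open MeasureTheory Filter Topology

noncomputable section

/-! ### Spectral measures and spectral projections of a bounded self-adjoint operator -/

section SpectralProjection

variable {H : Type*} [NormedAddCommGroup H] [InnerProductSpace ℂ H] [CompleteSpace H]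

/-- `f(T)`: the continuous functional calculus of a bounded self-adjoint operator `T`. -/
def operatorFunction (f : ℝ → ℝ) (T : H →L[ℂ] H) : H →L[ℂ] H := cfc f T

/-- The positive linear functional `f ↦ ⟪x, f(T) x⟫` on compactly supported continuous functions,
for a bounded self-adjoint operator `T`. -/
def spectralFunctional (T : H →L[ℂ] H) (x : H) :
    CompactlySupportedContinuousMap ℝ ℝ →ₚ[ℝ] ℝ :=
  PositiveLinearMap.mk₀
    { toFun := fun f => (inner ℂ x (operatorFunction f T x)).re
      map_add' := by
        intro f g
        have h : operatorFunction (⇑(f + g)) T = operatorFunction f T + operatorFunction g T := by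
          unfold operatorFunction
          rw [← cfc_add T (f : ℝ → ℝ) (g : ℝ → ℝ) f.continuous.continuousOn
            g.continuous.continuousOn]
          rfl
        rw [h, _root_.add_apply, inner_add_right, Complex.add_re]
      map_smul' := by
        intro r f
        have h : operatorFunction (⇑(r • f)) T = r • operatorFunction f T := by
          unfold operatorFunction
          rw [← cfc_smul r (f : ℝ → ℝ) T f.continuous.continuousOn]
          rfl
        rw [h, _root_.smul_apply, inner_smul_right_eq_smul, Complex.smul_re]
        rfl }
    (by
      intro f hf
      have h0 : (0 : H →L[ℂ] H) ≤ operatorFunction f T := cfc_nonneg fun l _ => hf l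
      exact ((ContinuousLinearMap.nonneg_iff_isPositive _).1 h0).re_inner_nonneg_right x)

/-- The scalar spectral measure `μ_x` of `T` at `x`: the Borel measure on `ℝ` with
`∫ f dμ_x = ⟪x, f(T) x⟫` for all compactly supported continuous `f`
(Riesz-Markov-Kakutani). -/
def spectralMeasure (T : H →L[ℂ] H) (x : H) : Measure ℝ :=
  RealRMK.rieszMeasure (spectralFunctional T x)

/-- The spectral subspace of `T` over a Borel set `B`: the vectors whose scalar spectral measure is
concentrated on `B`. (For Borel `B` these vectors already form a closed subspace, the range of the
value at `B` of the projection-valued measure of `T`; span and closure only supply the structure.) -/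
def spectralSubspace (T : H →L[ℂ] H) (B : Set ℝ) : Submodule ℂ H :=
  (Submodule.span ℂ {x : H | spectralMeasure T x Bᶜ = 0}).topologicalClosure

/-- The projection-valued measure `E` of the bounded self-adjoint operator `T`: for Borel `B`,
`E(B)` is the orthogonal projection onto the spectral subspace over `B`. -/
def spectralProjection (T : H →L[ℂ] H) (B : Set ℝ) : H →L[ℂ] H :=
  haveI : CompleteSpace (spectralSubspace T B) :=
    (Submodule.isClosed_topologicalClosure _).completeSpace_coe
  (spectralSubspace T B).starProjection

end SpectralProjection

/-! ### The torus and its limit graphexon operator -/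

/-- The normalized Haar (Lebesgue) measure on the torus `𝕋² = (ℝ/ℤ)²`. -/
abbrev torusMeasure : Measure (UnitAddTorus (Fin 2)) :=
  Measure.pi fun _ : Fin 2 => (AddCircle.haarAddCircle : Measure UnitAddCircle)

/-- The Hilbert space `L²(𝕋², ν)` of complex-valued functions. -/
abbrev L2Torus : Type := Lp ℂ 2 torusMeasure

/-- The constant function with value `z`, as an element of `L²(𝕋², ν)`. -/
def constL2 (z : ℂ) : L2Torus := Lp.const 2 torusMeasure z

/-- `L²₀(𝕋², ν)`: the orthogonal complement of the constant functions. -/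
abbrev L2Zero : Submodule ℂ L2Torus := (Submodule.span ℂ (Set.range constL2))ᗮ

/-- The action `x ↦ T x mod 1` of `T ∈ SL(2, ℤ)` on the torus. -/
def torusAction (T : Matrix.SpecialLinearGroup (Fin 2) ℤ) :
    UnitAddTorus (Fin 2) →+ UnitAddTorus (Fin 2) where
  toFun x := fun i => ∑ j, T.1 i j • x j
  map_zero' := by ext i; simp
  map_add' x y := by ext i; simp [Finset.sum_add_distrib]

theorem torusAction_mul (S T : Matrix.SpecialLinearGroup (Fin 2) ℤ) (x : UnitAddTorus (Fin 2)) :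
    torusAction (S * T) x = torusAction S (torusAction T x) := by
  ext i
  simp only [torusAction, AddMonoidHom.coe_mk, ZeroHom.coe_mk, Matrix.SpecialLinearGroup.coe_mul,
    Matrix.mul_apply, Fin.sum_univ_two, smul_add, add_smul, mul_smul]
  abel

theorem torusAction_one (x : UnitAddTorus (Fin 2)) : torusAction 1 x = x := by
  ext i
  fin_cases i <;> simp [torusAction, Fin.sum_univ_two]

theorem continuous_torusAction (T : Matrix.SpecialLinearGroup (Fin 2) ℤ) :
    Continuous (torusAction T) := by
  refine continuous_pi fun i => ?_
  change Continuous fun x : UnitAddTorus (Fin 2) => ∑ j, T.1 i j • x j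
  fun_prop

theorem measurePreserving_torusAction (T : Matrix.SpecialLinearGroup (Fin 2) ℤ) :
    MeasurePreserving (torusAction T) torusMeasure torusMeasure := by
  refine AddMonoidHom.measurePreserving (continuous_torusAction T) (fun y => ?_) rfl
  exact ⟨torusAction T⁻¹ y, by rw [← torusAction_mul, mul_inv_cancel, torusAction_one]⟩

/-- The composition operator `f ↦ f ∘ T` on `L²(𝕋², ν)`. -/
def koopman (T : Matrix.SpecialLinearGroup (Fin 2) ℤ) : L2Torus →L[ℂ] L2Torus :=
  (Lp.compMeasurePreservingₗᵢ ℂ (torusAction T) (measurePreserving_torusAction T)).toContinuousLinearMap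

/-- `T₁ = (1 2; 0 1)`. -/
def T₁ : Matrix.SpecialLinearGroup (Fin 2) ℤ := ⟨!![1, 2; 0, 1], by simp⟩

/-- `T₂ = (1 0; 2 1)`. -/
def T₂ : Matrix.SpecialLinearGroup (Fin 2) ℤ := ⟨!![1, 0; 2, 1], by simp⟩

/-- The limit graphexon operator
`(𝒢 f)(x) = (f(T₁ x) + f(T₁⁻¹ x) + f(T₂ x) + f(T₂⁻¹ x)) / 4` on `L²(𝕋², ν)`. -/
def graphexonOp : L2Torus →L[ℂ] L2Torus :=
  (1 / 4 : ℂ) • (koopman T₁ + koopman T₁⁻¹ + koopman T₂ + koopman T₂⁻¹)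

theorem koopman_koopman_inv (T : Matrix.SpecialLinearGroup (Fin 2) ℤ) (f : L2Torus) :
    koopman T (koopman T⁻¹ f) = f := by
  apply Lp.ext
  have h1 : (koopman T (koopman T⁻¹ f) : L2Torus) =ᵐ[torusMeasure]
      (koopman T⁻¹ f : L2Torus) ∘ torusAction T :=
    Lp.coeFn_compMeasurePreserving _ (measurePreserving_torusAction T)
  have h2 : (koopman T⁻¹ f : L2Torus) =ᵐ[torusMeasure] f ∘ torusAction T⁻¹ :=
    Lp.coeFn_compMeasurePreserving _ (measurePreserving_torusAction T⁻¹)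
  have h3 := (measurePreserving_torusAction T).quasiMeasurePreserving.ae_eq_comp h2
  filter_upwards [h1, h3] with x hx1 hx3
  rw [hx1, hx3]
  simp only [Function.comp_apply]
  rw [← torusAction_mul, inv_mul_cancel, torusAction_one]

theorem inner_koopman (T : Matrix.SpecialLinearGroup (Fin 2) ℤ) (f g : L2Torus) :
    inner ℂ (koopman T f) g = inner ℂ f (koopman T⁻¹ g) := by
  conv_lhs => rw [← koopman_koopman_inv T g]
  exact (Lp.compMeasurePreservingₗᵢ ℂ (torusAction T)
    (measurePreserving_torusAction T)).inner_map_map f (koopman T⁻¹ g)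

theorem graphexonOp_isSelfAdjoint : IsSelfAdjoint graphexonOp := by
  rw [ContinuousLinearMap.isSelfAdjoint_iff_isSymmetric]
  intro f g
  have h1 := inner_koopman T₁ f g
  have h2 := inner_koopman T₁⁻¹ f g
  have h3 := inner_koopman T₂ f g
  have h4 := inner_koopman T₂⁻¹ f g
  rw [inv_inv] at h2 h4
  simp only [graphexonOp, ContinuousLinearMap.coe_coe, _root_.smul_apply,
    _root_.add_apply, inner_smul_left, inner_smul_right, inner_add_left,
    inner_add_right, h1, h2, h3, h4]
  simp only [map_div₀, map_one, map_ofNat]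
  ring

theorem koopman_const (T : Matrix.SpecialLinearGroup (Fin 2) ℤ) (z : ℂ) :
    koopman T (constL2 z) = constL2 z := by
  apply Lp.ext
  have h1 : (koopman T (constL2 z) : L2Torus) =ᵐ[torusMeasure] (constL2 z) ∘ torusAction T :=
    Lp.coeFn_compMeasurePreserving _ (measurePreserving_torusAction T)
  have h2 : (constL2 z : L2Torus) =ᵐ[torusMeasure] Function.const _ z := Lp.coeFn_const ..
  have h3 := (measurePreserving_torusAction T).quasiMeasurePreserving.ae_eq_comp h2
  filter_upwards [h1, h2, h3] with x hx1 hx2 hx3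
  rw [hx1, hx3, hx2]
  rfl

theorem graphexonOp_const (z : ℂ) : graphexonOp (constL2 z) = constL2 z := by
  simp only [graphexonOp, _root_.smul_apply, _root_.add_apply,
    koopman_const]
  module

theorem graphexonOp_mem_L2Zero (f : L2Zero) : graphexonOp f ∈ L2Zero := by
  have hf := f.2
  rw [Submodule.mem_orthogonal] at hf ⊢
  intro u hu
  have hfix : graphexonOp u = u := by
    induction hu using Submodule.span_induction with
    | mem x hx => obtain ⟨z, rfl⟩ := hx; exact graphexonOp_const z
    | zero => simp
    | add x y _ _ hx hy => rw [map_add, hx, hy]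
    | smul c x _ hx => rw [map_smul, hx]
  have hsymm := (ContinuousLinearMap.isSelfAdjoint_iff_isSymmetric.1 graphexonOp_isSelfAdjoint) u f
  simp only [ContinuousLinearMap.coe_coe, hfix] at hsymm
  rw [← hsymm]
  exact hf u hu

/-- The restriction of `𝒢` to `L²₀(𝕋², ν)`. -/
def graphexonOpZero : L2Zero →L[ℂ] L2Zero :=
  (graphexonOp.comp L2Zero.subtypeL).codRestrict L2Zero graphexonOp_mem_L2Zero

/-- `ρ`: the spectral radius of `𝒢` restricted to `L²₀(𝕋², ν)`. -/
def rho : ℝ := (spectralRadius ℂ graphexonOpZero).toReal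

/-- `Σ₀ = [-ρ, ρ]`. -/
def sigmaZero : Set ℝ := Set.Icc (-rho) rho

/-! ### The linear-quadratic mean field game -/

/-- The parameters of the game: `dx = (a x + b u + c 𝒢m) dt + σ dW`, running cost
`(q (x - η 𝒢m)² + r u²) / 2`, discount rate `γ`; and the unique positive solution `Π` (here `Pi`) of
the scalar algebraic Riccati equation `2 Π (a - γ/2) - (b²/r) Π² + q = 0`.
The noise intensity `σ` does not enter the mean field. -/
structure LQGParameters where
  (a b c γ q r η Pi : ℝ)
  b_ne : b ≠ 0
  c_ne : c ≠ 0
  γ_pos : 0 < γ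
  q_nonneg : 0 ≤ q
  r_pos : 0 < r
  Pi_pos : 0 < Pi
  riccati : 2 * Pi * (a - γ / 2) - b ^ 2 / r * Pi ^ 2 + q = 0

namespace LQGParameters

variable (θ : LQGParameters)

/-- `k = b²/r`. -/
def k : ℝ := θ.b ^ 2 / θ.r

/-- `a_c = a - k Π`. -/
def ac : ℝ := θ.a - θ.k * θ.Pi

/-- `a_γ = a_c - γ/2`. -/
def aγ : ℝ := θ.ac - θ.γ / 2

/-- The network coupling factor `ψ = c Π - q η`. -/
def ψ : ℝ := θ.c * θ.Pi - θ.q * θ.η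

/-- The scalar algebraic Riccati equation at mode `l`, with unknown `p`. -/
def SARE (l p : ℝ) : Prop :=
  -θ.k * p ^ 2 + (2 * θ.ac - θ.γ + l * θ.c) * p + l * θ.ψ = 0

/-- The discriminant `Δ(l) = c² l² + 4 (a_γ c + k ψ) l + 4 a_γ²`. -/
def disc (l : ℝ) : ℝ := θ.c ^ 2 * l ^ 2 + 4 * (θ.aγ * θ.c + θ.k * θ.ψ) * l + 4 * θ.aγ ^ 2

/-- The stabilizing branch `p(l) = (2 a_γ + l c + √Δ(l)) / (2 k)`. -/
def p (l : ℝ) : ℝ := (2 * θ.aγ + l * θ.c + Real.sqrt (θ.disc l)) / (2 * θ.k)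

/-- The closed-loop generator `𝒜_cl(l) = (γ + l c - √Δ(l)) / 2`. -/
def Acl (l : ℝ) : ℝ := (θ.γ + l * θ.c - Real.sqrt (θ.disc l)) / 2

/-- `μ_max`: the supremum of `𝒜_cl` over `Σ₀`. -/
def μmax : ℝ := sSup (θ.Acl '' sigmaZero)

/-- Turing-type topological instability: the uncoupled local dynamics are stable, the average state
is stable, and the deviation field is unstable. -/
def TuringInstability : Prop := θ.ac < 0 ∧ θ.Acl 1 < 0 ∧ 0 < θ.μmax

/-- `l` is the dominant spectral mode: the unique point of `Σ₀` at which `𝒜_cl` attains `μ_max`. -/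
def IsDominantMode (l : ℝ) : Prop :=
  l ∈ sigmaZero ∧ θ.Acl l = θ.μmax ∧ ∀ l' ∈ sigmaZero, θ.Acl l' = θ.μmax → l' = l

/-- The decoupling operator `P(𝒢)` on `L²(𝕋², ν)`. -/
def decoupling : L2Torus →L[ℂ] L2Torus := operatorFunction θ.p graphexonOp

/-- `m` is a closed-loop global mean state: with `S_t = P(𝒢) m_t`,
`ṁ_t = (a_c I + c 𝒢) m_t - k S_t` for all `t ≥ 0` (one-sided derivative at `t = 0`). -/
def IsClosedLoopMeanState (m : ℝ → L2Torus) : Prop :=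
  ∀ t : ℝ, 0 ≤ t → HasDerivWithinAt m
    (θ.ac • m t + θ.c • graphexonOp (m t) - θ.k • θ.decoupling (m t)) (Set.Ici 0) t

end LQGParameters

/-- The spatial deviation field `e_t = m_t - m̄_t`, where `m̄_t = ∫ m_t dν`. -/
def deviation (m : ℝ → L2Torus) (t : ℝ) : L2Torus :=
  m t - constL2 (∫ x, m t x ∂torusMeasure)

/-- The normalized deviation field `ẽ_t = e_t / ‖e_t‖`. -/
def normalizedDeviation (m : ℝ → L2Torus) (t : ℝ) : L2Torus :=
  (‖deviation m t‖⁻¹ : ℝ) • deviation m t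

end

/-! On `L2Zero` the deviation solves a linear equation with generator `θ.Acl` of 𝒢, so e_t = exp(t
𝒜_cl(𝒢)) e_0. Because 𝒜_cl has a strict maximum over Σ₀ at λ*, and e_0 has spectral mass arbitrarily
near λ*, the normalized field concentrates spectrally there: ‖(𝒢 - λ*) ẽ_t‖ → 0
(`tendsto_operatorFunction_exp_concentration`). If λ* is not an eigenvalue, the self-adjoint
operator 𝒢 - λ* has dense range in L²₀, and ⟨ẽ_t, (𝒢 - λ*)χ⟩ = ⟨(𝒢 - λ*)ẽ_t, χ⟩ → 0 forces weak
convergence to zero. A norm limit would then be a unit vector orthogonal to itself.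

The arithmetic core is that 𝒢 has no eigenfunction in L²₀ (`eq_zero_of_graphexonOp_eq_smul`). On
Fourier coefficients 𝒢 averages over the four shears of ℤ². Off the axes and diagonals each point
has one neighbour of smaller sup norm and three of larger, as in a 4-regular tree. A Schur test with
weights √3^{±1} bounds any ℓ² eigenvalue by √3/2 in absolute value. For such eigenvalues the sums
over generations of descendants obey a recurrence whose characteristic roots have modulus √3, while
Cauchy-Schwarz and square-summability make these sums o(3^{n/2}); hence they vanish. -/

/-! ### Tree structure of ℤ² under the shears. -/

/-- The sup norm on `ℤ²`. -/
def latticeNorm (v : ℤ × ℤ) : ℕ := max v.1.natAbs v.2.natAbs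

/-- Lattice points with exactly one neighbour of smaller sup norm. -/
def IsBranchPoint (v : ℤ × ℤ) : Prop := v.1 ≠ 0 ∧ v.2 ≠ 0 ∧ v.1.natAbs ≠ v.2.natAbs

/-- The neighbour of smaller sup norm of a branch point. -/
def latticeParent (v : ℤ × ℤ) : ℤ × ℤ :=
  if v.2.natAbs < v.1.natAbs then (v.1 - 2 * ((v.1.sign * v.2.sign) * v.2), v.2)
  else (v.1, v.2 - 2 * ((v.1.sign * v.2.sign) * v.1))

/-- The three neighbours of larger sup norm of a branch point. -/
def latticeChildren (v : ℤ × ℤ) : Finset (ℤ × ℤ) :=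
  if v.2.natAbs < v.1.natAbs then
    {(v.1 + 2 * ((v.1.sign * v.2.sign) * v.2), v.2), (v.1, v.2 + 2 * v.1), (v.1, v.2 - 2 * v.1)}
  else
    {(v.1, v.2 + 2 * ((v.1.sign * v.2.sign) * v.1)), (v.1 + 2 * v.2, v.2), (v.1 - 2 * v.2, v.2)}

/-- Turns the product of signs, nonlinear for `omega`, into ±1 together with linear sign conditions.
-/
theorem sign_mul_sign_cases {x y : ℤ} (hx : x ≠ 0) (hy : y ≠ 0) :
    (x.sign * y.sign = 1 ∧ (0 < x ∧ 0 < y ∨ x < 0 ∧ y < 0)) ∨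
      (x.sign * y.sign = -1 ∧ (0 < x ∧ y < 0 ∨ x < 0 ∧ 0 < y)) := by
  rcases lt_or_gt_of_ne hx with h | h <;> rcases lt_or_gt_of_ne hy with h' | h' <;>
    simp [Int.sign_eq_one_of_pos, Int.sign_eq_neg_one_of_neg, h, h']

/-- If |y| < |x|, a child has either |x| + 2|y| in place of |x|, or 2|x| ± |y| in place of |y|. The
altered coordinate strictly dominates and the other is unchanged, so the child is again off the axes
and diagonals, and the step that reduces its larger coordinate leads back to the start. -/
theorem mem_latticeChildren {v w : ℤ × ℤ} (hv : IsBranchPoint v) (hw : w ∈ latticeChildren v) :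
    IsBranchPoint w ∧ latticeParent w = v ∧ latticeNorm v < latticeNorm w := by
  obtain ⟨x, y⟩ := v
  obtain ⟨z, u⟩ := w
  obtain ⟨hx, hy, hxy⟩ := hv
  simp only at hx hy hxy
  simp only [latticeChildren] at hw
  have key : z ≠ 0 ∧ u ≠ 0 ∧ z.natAbs ≠ u.natAbs := by
    rcases sign_mul_sign_cases hx hy with ⟨hs, h⟩ | ⟨hs, h⟩ <;> rw [hs] at hw <;>
      split_ifs at hw <;> simp only [Finset.mem_insert, Finset.mem_singleton, Prod.mk.injEq] at hw <;>
      omega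
  refine ⟨key, ?_, ?_⟩
  · simp only [latticeParent]
    rcases sign_mul_sign_cases hx hy with ⟨hs, h⟩ | ⟨hs, h⟩ <;> rw [hs] at hw <;>
      rcases sign_mul_sign_cases key.1 key.2.1 with ⟨hs', h'⟩ | ⟨hs', h'⟩ <;> rw [hs'] <;>
      split_ifs at hw ⊢ <;>
      simp only [Finset.mem_insert, Finset.mem_singleton, Prod.mk.injEq] at hw ⊢ <;> omega
  · simp only [latticeNorm]
    rcases sign_mul_sign_cases hx hy with ⟨hs, h⟩ | ⟨hs, h⟩ <;> rw [hs] at hw <;>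
      split_ifs at hw <;> simp only [Finset.mem_insert, Finset.mem_singleton, Prod.mk.injEq] at hw <;>
      omega

theorem card_latticeChildren {v : ℤ × ℤ} (hv : IsBranchPoint v) : (latticeChildren v).card = 3 := by
  obtain ⟨x, y⟩ := v
  obtain ⟨hx, hy, hxy⟩ := hv
  simp only at hx hy hxy
  simp only [latticeChildren]
  rcases sign_mul_sign_cases hx hy with ⟨hs, h⟩ | ⟨hs, h⟩ <;> rw [hs] <;> split_ifs <;>
    rw [Finset.card_eq_three] <;> refine ⟨_, _, _, ?_, ?_, ?_, rfl⟩ <;>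
    simp only [ne_eq, Prod.mk.injEq] <;> omega

/-! ### Eigenfunctions and sums over generations. -/

/-- `F` is an eigenfunction of the lattice Hecke-type operator with eigenvalue `l`. -/
def IsLatticeEigenfunction (l : ℝ) (F : ℤ × ℤ → ℝ) : Prop :=
  ∀ x y : ℤ, F (x, y + 2 * x) + F (x, y - 2 * x) + F (x + 2 * y, y) + F (x - 2 * y, y)
    = 4 * l * F (x, y)

namespace IsLatticeEigenfunction

variable {l : ℝ} {F : ℤ × ℤ → ℝ}

theorem sum_children (hF : IsLatticeEigenfunction l F) {v : ℤ × ℤ} (hv : IsBranchPoint v) :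
    ∑ w ∈ latticeChildren v, F w = 4 * l * F v - F (latticeParent v) := by
  obtain ⟨x, y⟩ := v
  obtain ⟨hx, hy, hxy⟩ := hv
  simp only at hx hy hxy
  have h0 := hF x y
  simp only [latticeChildren, latticeParent]
  rcases sign_mul_sign_cases hx hy with ⟨hs, h⟩ | ⟨hs, h⟩ <;> rw [hs] <;> split_ifs <;>
    rw [Finset.sum_insert, Finset.sum_insert, Finset.sum_singleton, ← h0] <;>
    simp only [Finset.mem_insert, Finset.mem_singleton, Prod.mk.injEq, one_mul, neg_one_mul, mul_neg,
      ← sub_eq_add_neg, sub_neg_eq_add] <;>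
    first | omega | ring1

end IsLatticeEigenfunction

/-- The descendants at depth `n` of `v`. -/
def latticeDescendants (v : ℤ × ℤ) : ℕ → Finset (ℤ × ℤ)
  | 0 => {v}
  | n + 1 => (latticeDescendants v n).biUnion latticeChildren

theorem mem_latticeDescendants {v : ℤ × ℤ} (hv : IsBranchPoint v) (n : ℕ) :
    ∀ w ∈ latticeDescendants v n, IsBranchPoint w ∧ n ≤ latticeNorm w := by
  induction n with
  | zero => simpa [latticeDescendants] using hv
  | succ n ih =>
    intro w hw
    obtain ⟨u, hu, hwu⟩ := Finset.mem_biUnion.1 hw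
    obtain ⟨h1, h2⟩ := ih u hu
    obtain ⟨h3, -, h4⟩ := mem_latticeChildren h1 hwu
    exact ⟨h3, by omega⟩

/-- The families of children are disjoint because a child determines its parent. -/
theorem sum_latticeDescendants_succ {M : Type*} [AddCommMonoid M] {v : ℤ × ℤ}
    (hv : IsBranchPoint v) (n : ℕ) (f : ℤ × ℤ → M) :
    ∑ w ∈ latticeDescendants v (n + 1), f w
      = ∑ w ∈ latticeDescendants v n, ∑ u ∈ latticeChildren w, f u := by
  refine Finset.sum_biUnion fun a ha b hb hab => Finset.disjoint_left.2 fun u hua hub => hab ?_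
  rw [← (mem_latticeChildren (mem_latticeDescendants hv n a ha).1 hua).2.1,
    (mem_latticeChildren (mem_latticeDescendants hv n b hb).1 hub).2.1]

theorem sum_latticeDescendants_parent {v : ℤ × ℤ} (hv : IsBranchPoint v) (n : ℕ)
    (f : ℤ × ℤ → ℝ) :
    ∑ w ∈ latticeDescendants v (n + 1), f (latticeParent w)
      = 3 * ∑ w ∈ latticeDescendants v n, f w := by
  rw [sum_latticeDescendants_succ hv, Finset.mul_sum]
  refine Finset.sum_congr rfl fun w hw => ?_
  have hw' := (mem_latticeDescendants hv n w hw).1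
  rw [Finset.sum_congr rfl fun u hu => by rw [(mem_latticeChildren hw' hu).2.1], Finset.sum_const,
    card_latticeChildren hw', nsmul_eq_mul]
  norm_num

theorem card_latticeDescendants {v : ℤ × ℤ} (hv : IsBranchPoint v) (n : ℕ) :
    (latticeDescendants v n).card = 3 ^ n := by
  induction n with
  | zero => rfl
  | succ n ih =>
    rw [Finset.card_eq_sum_ones, sum_latticeDescendants_succ hv, pow_succ, ← ih,
      Finset.sum_congr rfl fun w hw => by
        rw [← Finset.card_eq_sum_ones, card_latticeChildren (mem_latticeDescendants hv n w hw).1]]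
    simp

/-- Depth-n descendants have sup norm at least n, so they leave every finite set. -/
theorem tendsto_sum_latticeDescendants {f : ℤ × ℤ → ℝ} (hf : Summable f) {v : ℤ × ℤ}
    (hv : IsBranchPoint v) :
    Tendsto (fun n => ∑ w ∈ latticeDescendants v n, f w) atTop (𝓝 0) := by
  intro U hU
  obtain ⟨s, hs⟩ := summable_iff_vanishing.1 hf U hU
  rw [Filter.mem_map]
  filter_upwards [Filter.eventually_gt_atTop (s.sup latticeNorm)] with n hn
  refine hs _ (Finset.disjoint_left.2 fun w hw hws => ?_)
  have h1 := (mem_latticeDescendants hv n w hw).2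
  have h2 := Finset.le_sup (f := latticeNorm) hws
  omega

/-- A solution of `s (n + 2) = 4 l s (n + 1) - 3 s n` with `4 l² ≤ 3` and `s n = o(3 ^ (n / 2))`
vanishes. -/
theorem recurrence_eq_zero {l : ℝ} (hl : 4 * l ^ 2 ≤ 3) {s : ℕ → ℝ}
    (hs : ∀ n, s (n + 2) = 4 * l * s (n + 1) - 3 * s n)
    (hlim : Tendsto (fun n => s n ^ 2 / 3 ^ n) atTop (𝓝 0)) :
    s 0 = 0 ∧ s 1 = 0 := by
  -- This is s(n+1)² - 4l s(n+1) s(n) + 3 s(n)² with the square completed: the recurrence multiplies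
  -- it by exactly 3, and 4l² ≤ 3 makes it nonnegative.
  set Q : ℕ → ℝ := fun n => (s (n + 1) - 2 * l * s n) ^ 2 + (3 - 4 * l ^ 2) * s n ^ 2 with hQ
  have hQ3 : ∀ n, Q n = 3 ^ n * Q 0 := by
    intro n
    induction n with
    | zero => simp
    | succ n ih =>
      rw [pow_succ, mul_right_comm, ← ih]
      simp only [hQ]
      rw [show n + 1 + 1 = n + 2 from rfl, hs n]
      ring
  have hQ0 : Q 0 = 0 := by
    have hb : ∀ n, Q 0 ≤ 6 * (s (n + 1) ^ 2 / 3 ^ (n + 1)) + 9 * (s n ^ 2 / 3 ^ n) := by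
      intro n
      have h3 : (0 : ℝ) < 3 ^ n := by positivity
      have h1 : Q n ≤ 2 * s (n + 1) ^ 2 + 9 * s n ^ 2 := by
        simp only [hQ]
        nlinarith [sq_nonneg (s (n + 1) + 2 * l * s n),
          mul_nonneg (sub_nonneg.2 hl) (sq_nonneg (s n))]
      rw [hQ3 n] at h1
      have h2 : Q 0 ≤ (2 * s (n + 1) ^ 2 + 9 * s n ^ 2) / 3 ^ n := by
        rw [le_div_iff₀ h3]; linarith
      refine h2.trans_eq ?_
      rw [pow_succ]
      field_simp
      ring
    have h0 := ge_of_tendsto' (((hlim.comp (Filter.tendsto_add_atTop_nat 1)).const_mul 6).add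
      (hlim.const_mul 9)) hb
    have h1 : 0 ≤ Q 0 := by
      have := mul_nonneg (sub_nonneg.2 hl) (sq_nonneg (s 0))
      positivity
    linarith
  have hstep : ∀ n, s (n + 1) = 2 * l * s n ∧ (3 - 4 * l ^ 2) * s n ^ 2 = 0 := by
    intro n
    have h := hQ3 n
    rw [hQ0, mul_zero] at h
    have h1 := mul_nonneg (sub_nonneg.2 hl) (sq_nonneg (s n))
    have h2 := sq_nonneg (s (n + 1) - 2 * l * s n)
    simp only [hQ] at h
    refine ⟨?_, by linarith⟩
    have : (s (n + 1) - 2 * l * s n) ^ 2 = 0 := by linarith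
    exact sub_eq_zero.1 (pow_eq_zero_iff two_ne_zero |>.1 this)
  have h0 : s 0 = 0 := by
    by_contra hne
    have h34 : 4 * l ^ 2 = 3 := by
      have := (mul_eq_zero.1 (hstep 0).2).resolve_right (pow_ne_zero 2 hne)
      linarith
    -- Double root 2l = ±√3: the form Q is degenerate, and s is geometric with ratio 2l, too large
    -- to be o(3^{n/2}) unless it vanishes.
    have hconst : ∀ n, s n ^ 2 / 3 ^ n = s 0 ^ 2 := by
      intro n
      induction n with
      | zero => simp
      | succ n ih =>
        have h3 : s (n + 1) ^ 2 = s n ^ 2 * 3 := by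
          rw [(hstep n).1]
          linear_combination (s n) ^ 2 * h34
        rw [← ih, h3, pow_succ (3 : ℝ) n, mul_div_mul_right _ _ three_ne_zero]
    simp only [hconst] at hlim
    exact hne (pow_eq_zero_iff two_ne_zero |>.1 (tendsto_nhds_unique tendsto_const_nhds hlim))
  exact ⟨h0, by rw [(hstep 0).1, h0, mul_zero]⟩

namespace IsLatticeEigenfunction

variable {l : ℝ} {F : ℤ × ℤ → ℝ}

/-- Cauchy-Schwarz over the 3^n descendants bounds s(n)²/3^n by the sum of F² over generation n,
which tends to zero. The recurrence then gives s(0) = s(1) = 0; the second value yields the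
vanishing at the parent, which may itself lie on an axis or diagonal. -/
theorem eq_zero_of_isBranchPoint (hF : IsLatticeEigenfunction l F)
    (hsum : Summable fun v => F v ^ 2) (hl : 4 * l ^ 2 ≤ 3) {v : ℤ × ℤ} (hv : IsBranchPoint v) :
    F v = 0 ∧ F (latticeParent v) = 0 := by
  set s : ℕ → ℝ := fun n => ∑ w ∈ latticeDescendants v n, F w with hs
  have hrec : ∀ n, s (n + 2) = 4 * l * s (n + 1) - 3 * s n := by
    intro n
    simp only [hs]
    rw [sum_latticeDescendants_succ hv, ← sum_latticeDescendants_parent hv n F, Finset.mul_sum,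
      ← Finset.sum_sub_distrib]
    exact Finset.sum_congr rfl fun w hw =>
      hF.sum_children (mem_latticeDescendants hv (n + 1) w hw).1
  have hlim : Tendsto (fun n => s n ^ 2 / 3 ^ n) atTop (𝓝 0) := by
    refine squeeze_zero (fun n => by positivity) (fun n => ?_)
      (tendsto_sum_latticeDescendants hsum hv)
    rw [div_le_iff₀ (by positivity), mul_comm]
    have h := sq_sum_le_card_mul_sum_sq (s := latticeDescendants v n) (f := F)
    rwa [card_latticeDescendants hv, Nat.cast_pow, Nat.cast_ofNat] at h
  obtain ⟨h0, h1⟩ := recurrence_eq_zero hl hrec hlim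
  have h0' : F v = 0 := by simpa [hs, latticeDescendants] using h0
  refine ⟨h0', ?_⟩
  have h2 := hF.sum_children hv
  have h3 : s 1 = ∑ w ∈ latticeChildren v, F w := by simp [hs, latticeDescendants]
  rw [← h3, h1, h0'] at h2
  linarith

end IsLatticeEigenfunction

/-! ### Schur test -/

/-- The Schur weight attached to a step between lattice points of norms `a` and `b`. -/
noncomputable def schurWeight (a b : ℕ) : ℝ :=
  if a < b then (Real.sqrt 3)⁻¹ else if b < a then Real.sqrt 3 else 1

theorem schurWeight_pos (a b : ℕ) : 0 < schurWeight a b := by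
  unfold schurWeight; split_ifs <;> positivity

theorem schurWeight_le (a b : ℕ) : schurWeight a b ≤ 2 := by
  have h2 : Real.sqrt 3 ≤ 2 := by rw [Real.sqrt_le_left (by norm_num)]; norm_num
  have h1 : 1 ≤ Real.sqrt 3 := by rw [Real.one_le_sqrt]; norm_num
  have h3 := inv_le_one_of_one_le₀ h1
  unfold schurWeight; split_ifs <;> linarith

theorem schurWeight_mul_comm (a b : ℕ) : schurWeight a b * schurWeight b a = 1 := by
  have : Real.sqrt 3 ≠ 0 := by positivity
  unfold schurWeight; split_ifs <;> first | omega | field_simp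

theorem schurWeight_cases (a b : ℕ) :
    a < b ∧ schurWeight a b = Real.sqrt 3 / 3 ∨ b < a ∧ schurWeight a b = Real.sqrt 3 ∨
      a = b ∧ schurWeight a b = 1 := by
  have hinv : (Real.sqrt 3)⁻¹ = Real.sqrt 3 / 3 := by
    rw [inv_eq_one_div, div_eq_div_iff (by positivity) (by norm_num)]
    norm_num
  rcases lt_trichotomy a b with h | h | h
  · exact Or.inl ⟨h, by rw [schurWeight, if_pos h, hinv]⟩
  · exact Or.inr (Or.inr ⟨h, by rw [schurWeight, if_neg h.not_lt, if_neg h.not_gt]⟩)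
  · exact Or.inr (Or.inl ⟨h, by rw [schurWeight, if_neg h.not_gt, if_pos h]⟩)

theorem latticeNorm_swap (x y : ℤ) : latticeNorm (x, y) = latticeNorm (y, x) := max_comm _ _

theorem schurWeight_pair_of_lt {x y : ℤ} (h : y.natAbs < x.natAbs) :
    schurWeight (latticeNorm (x, y)) (latticeNorm (x, y + 2 * x)) +
      schurWeight (latticeNorm (x, y)) (latticeNorm (x, y - 2 * x)) = 2 * Real.sqrt 3 / 3 := by
  have h2 : latticeNorm (x, y) < latticeNorm (x, y + 2 * x) := by simp only [latticeNorm]; omega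
  have h3 : latticeNorm (x, y) < latticeNorm (x, y - 2 * x) := by simp only [latticeNorm]; omega
  rcases schurWeight_cases (latticeNorm (x, y)) (latticeNorm (x, y + 2 * x)) with e | e | e <;>
    rcases schurWeight_cases (latticeNorm (x, y)) (latticeNorm (x, y - 2 * x)) with f | f | f <;>
    first | linarith only [e.2, f.2] | (exfalso; omega)

theorem schurWeight_pair_of_gt {x y : ℤ} (h : x.natAbs < y.natAbs) :
    schurWeight (latticeNorm (x, y)) (latticeNorm (x, y + 2 * x)) +
      schurWeight (latticeNorm (x, y)) (latticeNorm (x, y - 2 * x)) ≤ 4 * Real.sqrt 3 / 3 := by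
  have h1 : 3 / 2 ≤ Real.sqrt 3 := Real.le_sqrt_of_sq_le (by norm_num)
  have h2 : latticeNorm (x, y + 2 * x) = latticeNorm (x, y) ∧
        latticeNorm (x, y - 2 * x) = latticeNorm (x, y) ∨
      latticeNorm (x, y) < latticeNorm (x, y + 2 * x) ∨
      latticeNorm (x, y) < latticeNorm (x, y - 2 * x) := by simp only [latticeNorm]; omega
  rcases schurWeight_cases (latticeNorm (x, y)) (latticeNorm (x, y + 2 * x)) with e | e | e <;>
    rcases schurWeight_cases (latticeNorm (x, y)) (latticeNorm (x, y - 2 * x)) with f | f | f <;>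
    first | linarith only [e.2, f.2, h1] | (exfalso; omega)

theorem schurWeight_pair_of_eq {x y : ℤ} (h : x.natAbs = y.natAbs) (hx : x ≠ 0) :
    schurWeight (latticeNorm (x, y)) (latticeNorm (x, y + 2 * x)) +
      schurWeight (latticeNorm (x, y)) (latticeNorm (x, y - 2 * x)) = 1 + Real.sqrt 3 / 3 := by
  have h2 : latticeNorm (x, y + 2 * x) = latticeNorm (x, y) ∧
        latticeNorm (x, y) < latticeNorm (x, y - 2 * x) ∨
      latticeNorm (x, y) < latticeNorm (x, y + 2 * x) ∧
        latticeNorm (x, y - 2 * x) = latticeNorm (x, y) := by simp only [latticeNorm]; omega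
  rcases schurWeight_cases (latticeNorm (x, y)) (latticeNorm (x, y + 2 * x)) with e | e | e <;>
    rcases schurWeight_cases (latticeNorm (x, y)) (latticeNorm (x, y - 2 * x)) with f | f | f <;>
    first | linarith only [e.2, f.2] | (exfalso; omega)

/-- One inward and three outward steps weigh √3 + 3/√3 = 2√3. On an axis or diagonal, two steps
preserve the norm and two go outward, for a total 2 + 2/√3, which is smaller. The origin is
excluded: its four steps weigh 4 > 2√3. -/
theorem schurWeight_sum_le (x y : ℤ) (h : (x, y) ≠ 0) :
    schurWeight (latticeNorm (x, y)) (latticeNorm (x, y + 2 * x)) +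
    schurWeight (latticeNorm (x, y)) (latticeNorm (x, y - 2 * x)) +
    schurWeight (latticeNorm (x, y)) (latticeNorm (x + 2 * y, y)) +
    schurWeight (latticeNorm (x, y)) (latticeNorm (x - 2 * y, y)) ≤ 2 * Real.sqrt 3 := by
  have h1 : 3 / 2 ≤ Real.sqrt 3 := Real.le_sqrt_of_sq_le (by norm_num)
  rw [add_assoc, latticeNorm_swap (x + 2 * y), latticeNorm_swap (x - 2 * y)]
  nth_rewrite 3 [latticeNorm_swap x y]
  nth_rewrite 3 [latticeNorm_swap x y]
  rcases lt_trichotomy x.natAbs y.natAbs with hxy | hxy | hxy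
  · linarith [schurWeight_pair_of_gt hxy, schurWeight_pair_of_lt hxy]
  · have hx : x ≠ 0 := by rintro rfl; exact h (by simpa using hxy.symm)
    have hy : y ≠ 0 := by omega
    linarith [schurWeight_pair_of_eq hxy hx, schurWeight_pair_of_eq hxy.symm hy]
  · linarith [schurWeight_pair_of_gt hxy, schurWeight_pair_of_lt hxy]

/-- Weighted AM-GM: the weights of a step and of its reverse have product one. -/
theorem abs_mul_le_schurWeight (a b : ℕ) (s t : ℝ) :
    |s * t| ≤ (schurWeight a b * s ^ 2 + schurWeight b a * t ^ 2) / 2 := by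
  have h0 := schurWeight_pos a b
  have h1 := schurWeight_mul_comm a b
  have h2 : schurWeight b a = (schurWeight a b)⁻¹ := eq_inv_of_mul_eq_one_right h1
  rw [h2, abs_le]
  have e : ∀ r : ℝ, 0 ≤ (schurWeight a b)⁻¹ * (schurWeight a b * s + r * t) ^ 2 := fun r => by
    positivity
  have e' : ∀ r : ℝ, (schurWeight a b)⁻¹ * (schurWeight a b * s + r * t) ^ 2
      = schurWeight a b * s ^ 2 + 2 * r * (s * t) + r ^ 2 * ((schurWeight a b)⁻¹ * t ^ 2) := by
    intro r
    field_simp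
    ring
  have p1 := e 1
  have p2 := e (-1)
  rw [e'] at p1 p2
  constructor <;> linarith

theorem summable_schurWeight_mul_sq {F : ℤ × ℤ → ℝ} (hsum : Summable fun v => F v ^ 2)
    (e : ℤ × ℤ ≃ ℤ × ℤ) :
    Summable fun v => schurWeight (latticeNorm v) (latticeNorm (e v)) * F v ^ 2 :=
  Summable.of_nonneg_of_le (fun _ => mul_nonneg (schurWeight_pos _ _).le (sq_nonneg _))
    (fun _ => mul_le_mul_of_nonneg_right (schurWeight_le _ _) (sq_nonneg _)) (hsum.mul_left 2)

theorem summable_mul_comp_equiv {F : ℤ × ℤ → ℝ} (hsum : Summable fun v => F v ^ 2)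
    (e : ℤ × ℤ ≃ ℤ × ℤ) : Summable fun v => F v * F (e v) := by
  refine Summable.of_norm_bounded (hsum.add (e.summable_iff.2 hsum)) fun v => ?_
  rw [Real.norm_eq_abs, abs_le]
  simp only [Function.comp_apply]
  constructor <;> nlinarith [sq_nonneg (F v + F (e v)), sq_nonneg (F v - F (e v)),
    sq_nonneg (F v), sq_nonneg (F (e v))]

/-- After AM-GM, reindexing by `e` moves the terms in `F (e v)` back to `v`, where they carry the
weight of the step `e.symm`. -/
theorem abs_tsum_mul_comp_equiv_le {F : ℤ × ℤ → ℝ} (hsum : Summable fun v => F v ^ 2)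
    (e : ℤ × ℤ ≃ ℤ × ℤ) :
    |∑' v, F v * F (e v)| ≤ ∑' v, (schurWeight (latticeNorm v) (latticeNorm (e v)) +
      schurWeight (latticeNorm v) (latticeNorm (e.symm v))) / 2 * F v ^ 2 := by
  have h1 := summable_schurWeight_mul_sq hsum e
  have h2 := summable_schurWeight_mul_sq hsum e.symm
  have h3 : Summable fun v => schurWeight (latticeNorm (e v)) (latticeNorm v) * F (e v) ^ 2 := by
    simpa [Function.comp_def] using e.summable_iff.2 h2
  have h4 : ∑' v, schurWeight (latticeNorm (e v)) (latticeNorm v) * F (e v) ^ 2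
      = ∑' v, schurWeight (latticeNorm v) (latticeNorm (e.symm v)) * F v ^ 2 := by
    simpa using e.tsum_eq fun v => schurWeight (latticeNorm v) (latticeNorm (e.symm v)) * F v ^ 2
  have hs := summable_mul_comp_equiv hsum e
  calc |∑' v, F v * F (e v)| ≤ ∑' v, |F v * F (e v)| := by
        simpa only [Real.norm_eq_abs] using norm_tsum_le_tsum_norm hs.norm
    _ ≤ ∑' v, (schurWeight (latticeNorm v) (latticeNorm (e v)) * F v ^ 2 +
          schurWeight (latticeNorm (e v)) (latticeNorm v) * F (e v) ^ 2) / 2 :=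
        hs.abs.tsum_le_tsum (fun v => abs_mul_le_schurWeight _ _ _ _) ((h1.add h3).div_const 2)
    _ = _ := by
        rw [tsum_div_const, h1.tsum_add h3, h4, ← h1.tsum_add h2, ← tsum_div_const]
        exact tsum_congr fun v => by ring

/-- The shear `(x, y) ↦ (x, y + 2x)` of `ℤ²`. -/
def latticeShear₁ : ℤ × ℤ ≃ ℤ × ℤ where
  toFun v := (v.1, v.2 + 2 * v.1)
  invFun v := (v.1, v.2 - 2 * v.1)
  left_inv v := by simp
  right_inv v := by simp

/-- The shear `(x, y) ↦ (x + 2y, y)` of `ℤ²`. -/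
def latticeShear₂ : ℤ × ℤ ≃ ℤ × ℤ where
  toFun v := (v.1 + 2 * v.2, v.2)
  invFun v := (v.1 - 2 * v.2, v.2)
  left_inv v := by simp
  right_inv v := by simp

namespace IsLatticeEigenfunction

variable {l : ℝ} {F : ℤ × ℤ → ℝ}

/-- Pair the eigenvalue equation with F. Each inverse shear contributes the same sum as the shear,
so two sums remain, and the four Schur weights at each point total at most 2√3. -/
theorem two_mul_abs_mul_tsum_le (hF : IsLatticeEigenfunction l F)
    (hsum : Summable fun v => F v ^ 2) (h0 : F 0 = 0) :
    2 * |l| * ∑' v, F v ^ 2 ≤ Real.sqrt 3 * ∑' v, F v ^ 2 := by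
  have e1 := summable_mul_comp_equiv hsum latticeShear₁
  have e2 := summable_mul_comp_equiv hsum latticeShear₂
  have e1' := summable_mul_comp_equiv hsum latticeShear₁.symm
  have e2' := summable_mul_comp_equiv hsum latticeShear₂.symm
  have hsymm : ∀ e : ℤ × ℤ ≃ ℤ × ℤ, ∑' v, F v * F (e.symm v) = ∑' v, F v * F (e v) := by
    intro e
    rw [← e.tsum_eq]
    exact tsum_congr fun v => by rw [e.symm_apply_apply, mul_comm]
  have hsumeq : 4 * l * ∑' v, F v ^ 2
      = 2 * (∑' v, F v * F (latticeShear₁ v) + ∑' v, F v * F (latticeShear₂ v)) := by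
    nth_rewrite 1 [two_mul]
    nth_rewrite 2 [← hsymm latticeShear₁, ← hsymm latticeShear₂]
    rw [← e1.tsum_add e2, ← e1'.tsum_add e2', ← (e1.add e2).tsum_add (e1'.add e2'), ← tsum_mul_left]
    refine tsum_congr fun v => ?_
    have := hF v.1 v.2
    simp only [latticeShear₁, latticeShear₂, Equiv.coe_fn_mk, Equiv.coe_fn_symm_mk]
    linear_combination (-F v) * this
  have b1 := abs_tsum_mul_comp_equiv_le hsum latticeShear₁
  have b2 := abs_tsum_mul_comp_equiv_le hsum latticeShear₂
  have hw : ∀ e : ℤ × ℤ ≃ ℤ × ℤ, Summable fun v =>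
      (schurWeight (latticeNorm v) (latticeNorm (e v)) +
        schurWeight (latticeNorm v) (latticeNorm (e.symm v))) / 2 * F v ^ 2 := fun e =>
    (((summable_schurWeight_mul_sq hsum e).add (summable_schurWeight_mul_sq hsum e.symm)).div_const
      2).congr fun v => by ring
  have hle := ((hw latticeShear₁).add (hw latticeShear₂)).tsum_le_tsum (fun v => by
    show _ ≤ Real.sqrt 3 * F v ^ 2
    rcases eq_or_ne v 0 with rfl | hv
    · simp [h0]
    · rw [← add_mul]
      refine mul_le_mul_of_nonneg_right ?_ (sq_nonneg _)
      have := schurWeight_sum_le v.1 v.2 hv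
      simp only [latticeShear₁, latticeShear₂, Equiv.coe_fn_mk, Equiv.coe_fn_symm_mk]
      linarith) (hsum.mul_left (Real.sqrt 3))
  rw [(hw _).tsum_add (hw _), tsum_mul_left] at hle
  have hnn : 0 ≤ ∑' v, F v ^ 2 := tsum_nonneg fun v => sq_nonneg _
  have habs : 2 * |l| * ∑' v, F v ^ 2
      = |∑' v, F v * F (latticeShear₁ v) + ∑' v, F v * F (latticeShear₂ v)| := by
    rw [show ∑' v, F v * F (latticeShear₁ v) + ∑' v, F v * F (latticeShear₂ v)
      = 2 * l * ∑' v, F v ^ 2 by linarith, abs_mul, abs_mul, abs_of_nonneg hnn, abs_two]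
  rw [habs]
  exact (abs_add_le _ _).trans (by linarith)

theorem four_mul_sq_le (hF : IsLatticeEigenfunction l F)
    (hsum : Summable fun v => F v ^ 2) (h0 : F 0 = 0) {v : ℤ × ℤ} (hv : F v ≠ 0) :
    4 * l ^ 2 ≤ 3 := by
  have hpos : 0 < ∑' v, F v ^ 2 := hsum.tsum_pos (fun v => sq_nonneg _) v (by positivity)
  have h := le_of_mul_le_mul_right (hF.two_mul_abs_mul_tsum_le hsum h0) hpos
  have h3 : Real.sqrt 3 ^ 2 = 3 := Real.sq_sqrt (by norm_num)
  have := pow_le_pow_left₀ (by positivity) h 2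
  rw [mul_pow, sq_abs, h3] at this
  linarith

/-- The lattice operator has no square-summable eigenfunction vanishing at the origin. -/
theorem eq_zero (hF : IsLatticeEigenfunction l F)
    (hsum : Summable fun v => F v ^ 2) (h0 : F 0 = 0) : F = 0 := by
  by_contra hne
  obtain ⟨w, hw⟩ := Function.ne_iff.1 hne
  have hl := hF.four_mul_sq_le hsum h0 hw
  refine hne (funext fun v => ?_)
  obtain ⟨x, y⟩ := v
  simp only [Pi.zero_apply]
  by_cases hb : IsBranchPoint (x, y)
  · exact (hF.eq_zero_of_isBranchPoint hsum hl hb).1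
  by_cases hxy : x = 0 ∧ y = 0
  · rw [hxy.1, hxy.2]; exact h0
  -- The points left are the nonzero ones on axes and diagonals; each is the parent of an explicit
  -- branch point.
  have key : ∀ u, IsBranchPoint u → latticeParent u = (x, y) → F (x, y) = 0 := fun u hu hp =>
    hp ▸ (hF.eq_zero_of_isBranchPoint hsum hl hu).2
  simp only [IsBranchPoint] at hb
  by_cases hx : x = 0
  · have hy : y ≠ 0 := by tauto
    refine key (2 * y, y) ⟨by simpa using hy, hy, by simp only; omega⟩ ?_
    simp only [latticeParent]
    rcases sign_mul_sign_cases (x := 2 * y) (y := y) (by omega) hy with ⟨hs, h⟩ | ⟨hs, h⟩ <;> rw [hs] <;>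
      split_ifs <;> simp only [Prod.mk.injEq, and_true] <;> omega
  by_cases hy : y = 0
  · refine key (x, 2 * x) ⟨hx, by simpa using hx, by simp only; omega⟩ ?_
    simp only [latticeParent]
    rcases sign_mul_sign_cases (x := x) (y := 2 * x) hx (by omega) with ⟨hs, h⟩ | ⟨hs, h⟩ <;> rw [hs] <;>
      split_ifs <;> simp only [Prod.mk.injEq, true_and] <;> omega
  have hxy' : x.natAbs = y.natAbs := by tauto
  refine key (3 * x, y) ⟨by simpa using hx, hy, by simp only; omega⟩ ?_
  simp only [latticeParent]
  rcases sign_mul_sign_cases (x := 3 * x) (y := y) (by omega) hy with ⟨hs, h⟩ | ⟨hs, h⟩ <;> rw [hs] <;>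
    split_ifs <;> simp only [Prod.mk.injEq, and_true] <;> omega

end IsLatticeEigenfunction

/-! ### Fourier transfer: 𝒢 has no eigenfunction in L²₀. -/

/-- Fourier modes as elements of `L²(𝕋², ν)`. -/
noncomputable def torusBasis : HilbertBasis (Fin 2 → ℤ) ℂ L2Torus :=
  UnitAddTorus.mFourierBasis

theorem coeFn_torusBasis (n : Fin 2 → ℤ) :
    (torusBasis n : UnitAddTorus (Fin 2) → ℂ) =ᵐ[torusMeasure] UnitAddTorus.mFourier n := by
  have h := UnitAddTorus.coeFn_mFourierLp (d := Fin 2) 2 n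
  rw [← UnitAddTorus.coe_mFourierBasis] at h
  exact h

theorem torusBasis_zero : torusBasis 0 = constL2 1 := by
  apply Lp.ext
  have h2 : (constL2 1 : L2Torus) =ᵐ[torusMeasure] Function.const _ 1 := Lp.coeFn_const ..
  filter_upwards [coeFn_torusBasis 0, h2] with x hx hx2
  rw [hx, hx2, UnitAddTorus.mFourier_zero]
  rfl

/-- Composing a character with T multiplies its frequency, as a row vector, by T on the right. -/
theorem mFourier_torusAction (T : Matrix.SpecialLinearGroup (Fin 2) ℤ) (n : Fin 2 → ℤ)
    (x : UnitAddTorus (Fin 2)) :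
    UnitAddTorus.mFourier n (torusAction T x)
      = UnitAddTorus.mFourier (fun j => ∑ i, n i * T.1 i j) x := by
  simp only [UnitAddTorus.mFourier, ContinuousMap.coe_mk, torusAction, AddMonoidHom.coe_mk,
    ZeroHom.coe_mk, Fin.prod_univ_two, Fin.sum_univ_two, fourier_apply, ← Circle.coe_mul,
    ← AddCircle.toCircle_add]
  congr 2
  simp only [smul_add, add_smul, mul_smul]
  abel

theorem koopman_torusBasis (T : Matrix.SpecialLinearGroup (Fin 2) ℤ) (n : Fin 2 → ℤ) :
    koopman T (torusBasis n) = torusBasis (fun j => ∑ i, n i * T.1 i j) := by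
  apply Lp.ext
  have h1 : (koopman T (torusBasis n) : L2Torus) =ᵐ[torusMeasure]
      (torusBasis n) ∘ torusAction T :=
    Lp.coeFn_compMeasurePreserving _ (measurePreserving_torusAction T)
  have h3 := (measurePreserving_torusAction T).quasiMeasurePreserving.ae_eq_comp (coeFn_torusBasis n)
  filter_upwards [h1, h3, coeFn_torusBasis (fun j => ∑ i, n i * T.1 i j)] with x hx1 hx3 hx2
  rw [hx1, hx3, hx2]
  exact mFourier_torusAction T n x

theorem coe_T₁_inv : (T₁⁻¹).1 = !![1, -2; 0, 1] := by
  rw [Matrix.SpecialLinearGroup.coe_inv]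
  simp [T₁, Matrix.adjugate_fin_two]

theorem coe_T₂_inv : (T₂⁻¹).1 = !![1, 0; -2, 1] := by
  rw [Matrix.SpecialLinearGroup.coe_inv]
  simp [T₂, Matrix.adjugate_fin_two]

theorem graphexonOp_torusBasis (x y : ℤ) :
    graphexonOp (torusBasis ![x, y]) = (1 / 4 : ℂ) •
      (torusBasis ![x, y + 2 * x] + torusBasis ![x, y - 2 * x] +
        torusBasis ![x + 2 * y, y] + torusBasis ![x - 2 * y, y]) := by
  simp only [graphexonOp, _root_.smul_apply, _root_.add_apply, koopman_torusBasis, coe_T₁_inv,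
    coe_T₂_inv]
  congr 5 <;> (ext j; fin_cases j) <;> simp [T₁, T₂, Fin.sum_univ_two] <;> ring

/-- `𝒢` has no eigenfunction in `L²₀`. -/
theorem eq_zero_of_graphexonOp_eq_smul {f : L2Torus} (hf : f ∈ L2Zero) {l : ℝ}
    (h : graphexonOp f = (l : ℂ) • f) : f = 0 := by
  set C : ℤ × ℤ → ℂ := fun v => inner ℂ (torusBasis ![v.1, v.2]) f with hC
  have hsymm := ContinuousLinearMap.isSelfAdjoint_iff_isSymmetric.1 graphexonOp_isSelfAdjoint
  have hrec : ∀ x y : ℤ, C (x, y + 2 * x) + C (x, y - 2 * x) + C (x + 2 * y, y) + C (x - 2 * y, y)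
      = 4 * l * C (x, y) := by
    intro x y
    have h1 := hsymm (torusBasis ![x, y]) f
    simp only [ContinuousLinearMap.coe_coe, h, graphexonOp_torusBasis, inner_smul_left,
      inner_smul_right, inner_add_left] at h1
    simp only [hC]
    simp only [map_div₀, map_one, map_ofNat] at h1
    linear_combination 4 * h1
  have hsum : Summable fun v => ‖C v‖ ^ 2 := by
    have := torusBasis.orthonormal.inner_products_summable f
    exact ((finTwoArrowEquiv ℤ).symm.summable_iff.2 this).congr fun v => rfl
  have hC0 : C 0 = 0 := by
    have : torusBasis 0 ∈ Submodule.span ℂ (Set.range constL2) := by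
      rw [torusBasis_zero]
      exact Submodule.subset_span ⟨1, rfl⟩
    have h1 := (Submodule.mem_orthogonal _ _).1 hf _ this
    have h2 : (![0, 0] : Fin 2 → ℤ) = 0 := by ext j; fin_cases j <;> rfl
    simpa [hC, h2] using h1
  -- The eigenvalue is real, so real and imaginary parts satisfy the equation separately.
  have hre : IsLatticeEigenfunction l fun v => (C v).re := fun x y => by
    have := congrArg Complex.re (hrec x y)
    simpa [mul_assoc] using this
  have him : IsLatticeEigenfunction l fun v => (C v).im := fun x y => by
    have := congrArg Complex.im (hrec x y)
    simpa [mul_assoc] using this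
  have hbound : ∀ v, (C v).re ^ 2 ≤ ‖C v‖ ^ 2 ∧ (C v).im ^ 2 ≤ ‖C v‖ ^ 2 := fun v => by
    rw [← Complex.normSq_eq_norm_sq, Complex.normSq_apply]
    constructor <;> nlinarith [sq_nonneg (C v).re, sq_nonneg (C v).im]
  have hre0 := hre.eq_zero (Summable.of_nonneg_of_le (fun _ => sq_nonneg _)
    (fun v => (hbound v).1) hsum) (by simp [hC0])
  have him0 := him.eq_zero (Summable.of_nonneg_of_le (fun _ => sq_nonneg _)
    (fun v => (hbound v).2) hsum) (by simp [hC0])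
  refine torusBasis.repr.map_eq_zero_iff.1 (lp.ext (funext fun n => ?_))
  rw [torusBasis.repr_apply_apply]
  have hn : C (n 0, n 1) = 0 := Complex.ext (congrFun hre0 _) (congrFun him0 _)
  have h2 : ![n 0, n 1] = n := by ext j; fin_cases j <;> rfl
  simpa [hC, h2] using hn

/-! ### Functional calculus and intertwining. -/

section FunctionalCalculus

theorem aeval_intertwine {H K : Type*} [NormedAddCommGroup H] [InnerProductSpace ℂ H]
    [NormedAddCommGroup K] [InnerProductSpace ℂ K] {T : H →L[ℂ] H} {S : K →L[ℂ] K} (L : K →L[ℂ] H)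
    (hL : ∀ x, T (L x) = L (S x)) (p : Polynomial ℝ) :
    ∀ x, Polynomial.aeval T p (L x) = L (Polynomial.aeval S p x) := by
  induction p using Polynomial.induction_on with
  | C a => intro x; simp [Algebra.algebraMap_eq_smul_one]
  | add p q hp hq => intro x; simp [hp, hq]
  | monomial n a h =>
    intro x
    rw [pow_succ, ← mul_assoc, map_mul, map_mul (Polynomial.aeval S), Polynomial.aeval_X,
      Polynomial.aeval_X, mul_apply_eq_comp, mul_apply_eq_comp, hL, h]

variable {H K : Type*} [NormedAddCommGroup H] [InnerProductSpace ℂ H] [CompleteSpace H]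
  [NormedAddCommGroup K] [InnerProductSpace ℂ K] [CompleteSpace K]

theorem cfc_apply_norm_le {T : H →L[ℂ] H} {f : ℝ → ℝ} {c : ℝ} (hc : 0 ≤ c)
    (h : ∀ l ∈ spectrum ℝ T, |f l| ≤ c) (x : H) : ‖cfc f T x‖ ≤ c * ‖x‖ :=
  ContinuousLinearMap.le_of_opNorm_le _ (norm_cfc_le hc h) x

theorem norm_aeval_sub_cfc_le {T : H →L[ℂ] H} (hT : IsSelfAdjoint T) {f : ℝ → ℝ}
    (hf : Continuous f) {p : Polynomial ℝ} {c : ℝ} (hc : 0 ≤ c)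
    (hp : ∀ l ∈ spectrum ℝ T, |p.eval l - f l| ≤ c) (x : H) :
    ‖Polynomial.aeval T p x - cfc f T x‖ ≤ c * ‖x‖ := by
  rw [← cfc_polynomial p T hT, ← _root_.sub_apply,
    ← cfc_sub _ _ T p.continuous.continuousOn hf.continuousOn]
  exact cfc_apply_norm_le hc hp x

/-- The continuous functional calculus commutes with intertwining operators. -/
theorem operatorFunction_intertwine {T : H →L[ℂ] H} {S : K →L[ℂ] K} (hT : IsSelfAdjoint T)
    (hS : IsSelfAdjoint S) (L : K →L[ℂ] H) (hL : ∀ x, T (L x) = L (S x)) {f : ℝ → ℝ}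
    (hf : Continuous f) (x : K) :
    operatorFunction f T (L x) = L (operatorFunction f S x) := by
  unfold operatorFunction
  obtain ⟨R, hR⟩ := ((ContinuousFunctionalCalculus.isCompact_spectrum (R := ℝ) T).union
    (ContinuousFunctionalCalculus.isCompact_spectrum (R := ℝ) S)).isBounded.subset_closedBall 0
  rw [Real.closedBall_eq_Icc] at hR
  rw [← sub_eq_zero, ← norm_le_zero_iff]
  refine le_of_forall_pos_le_add fun δ hδ => ?_
  have hC0 : 0 ≤ ‖L x‖ + ‖L‖ * ‖x‖ := by positivity
  generalize hC : ‖L x‖ + ‖L‖ * ‖x‖ = C at hC0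
  -- One polynomial approximates f on an interval containing both spectra; polynomials intertwine
  -- exactly. The denominator C + 1 avoids dividing by zero.
  obtain ⟨p, hp⟩ := exists_polynomial_near_of_continuousOn (0 - R) (0 + R) f hf.continuousOn
    (δ / (C + 1)) (by positivity)
  have hc : 0 ≤ δ / (C + 1) := by positivity
  have h1 := norm_aeval_sub_cfc_le hT hf hc
    (fun l hl => (hp l (hR (Set.mem_union_left _ hl))).le) (L x)
  have h2 := (L.le_opNorm _).trans (mul_le_mul_of_nonneg_left (norm_aeval_sub_cfc_le hS hf hc
    (fun l hl => (hp l (hR (Set.mem_union_right _ hl))).le) x) (norm_nonneg L))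
  rw [aeval_intertwine L hL, norm_sub_rev] at h1
  rw [map_sub] at h2
  refine (norm_sub_le_norm_sub_add_norm_sub _ (L (Polynomial.aeval S p x)) _).trans
    ((add_le_add h1 h2).trans ?_)
  calc _ = δ * (C / (C + 1)) := by rw [← hC]; ring
    _ ≤ δ * 1 := by
        refine mul_le_mul_of_nonneg_left ?_ hδ.le
        rw [div_le_one (by positivity)]
        linarith
    _ = 0 + δ := by ring

theorem inner_cfc_left (f : ℝ → ℝ) (T : H →L[ℂ] H) (x y : H) :
    inner ℂ (cfc f T x) y = inner ℂ x (cfc f T y) :=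
  (ContinuousLinearMap.isSelfAdjoint_iff_isSymmetric.1 (cfc_predicate f T)) x y

theorem cfc_mul_apply {T : H →L[ℂ] H} {f g : ℝ → ℝ} (hf : Continuous f) (hg : Continuous g)
    (x : H) : cfc (fun l => f l * g l) T x = cfc f T (cfc g T x) := by
  rw [cfc_mul f g T hf.continuousOn hg.continuousOn]
  rfl

/-! ### Spectral measures and cut-offs. -/

/-- Continuous cut-offs of the interval `(a, b)`. -/
noncomputable def intervalCutoff (a b : ℝ) (n : ℕ) (l : ℝ) : ℝ :=
  min 1 (n * max 0 (min (l - a) (b - l)))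

theorem continuous_intervalCutoff (a b : ℝ) (n : ℕ) : Continuous (intervalCutoff a b n) := by
  unfold intervalCutoff; fun_prop

theorem intervalCutoff_eq_zero {a b : ℝ} (n : ℕ) {l : ℝ} (hl : l ∉ Set.Ioo a b) :
    intervalCutoff a b n l = 0 := by
  have : min (l - a) (b - l) ≤ 0 := by
    rw [Set.mem_Ioo, not_and_or, not_lt, not_lt] at hl
    rcases hl with h | h
    · exact (min_le_left _ _).trans (by linarith)
    · exact (min_le_right _ _).trans (by linarith)
  simp [intervalCutoff, max_eq_left this]

theorem intervalCutoff_mem_Icc (a b : ℝ) (n : ℕ) (l : ℝ) :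
    0 ≤ intervalCutoff a b n l ∧ intervalCutoff a b n l ≤ 1 :=
  ⟨le_min zero_le_one (by positivity), min_le_left _ _⟩

theorem intervalCutoff_eventually_eq_one {a b l : ℝ} (hl : l ∈ Set.Ioo a b) :
    ∀ᶠ n : ℕ in atTop, intervalCutoff a b n l = 1 := by
  have h0 : 0 < min (l - a) (b - l) := lt_min (by linarith [hl.1]) (by linarith [hl.2])
  have h1 := (tendsto_natCast_atTop_atTop (R := ℝ)).atTop_mul_const h0
  filter_upwards [h1.eventually_ge_atTop 1] with n hn
  rw [intervalCutoff, max_eq_right h0.le, min_eq_left hn]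

theorem integral_spectralMeasure (T : H →L[ℂ] H) (x : H)
    (f : CompactlySupportedContinuousMap ℝ ℝ) :
    ∫ l, f l ∂spectralMeasure T x = (inner ℂ x (cfc f T x)).re :=
  RealRMK.integral_rieszMeasure _ f

theorem norm_sub_cfc_sq {T : H →L[ℂ] H} (hT : IsSelfAdjoint T) {f : ℝ → ℝ} (hf : Continuous f)
    (x : H) : (inner ℂ x (cfc (fun l => (1 - f l) * (1 - f l)) T x)).re = ‖x - cfc f T x‖ ^ 2 := by
  have e2 : ∀ y, cfc (fun l => 1 - f l) T y = y - cfc f T y := by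
    intro y
    rw [cfc_sub (fun _ => 1) _ T continuousOn_const hf.continuousOn, cfc_const 1 T hT]
    simp
  rw [cfc_mul_apply (by fun_prop) (by fun_prop), ← inner_cfc_left, e2]
  exact inner_self_eq_norm_sq (𝕜 := ℂ) _

/-- A vector whose spectral measure is carried by `(a, b)` is the limit of its cut-offs. -/
theorem tendsto_cfc_intervalCutoff {T : H →L[ℂ] H} (hT : IsSelfAdjoint T) {a b : ℝ} {x : H}
    (hx : spectralMeasure T x (Set.Ioo a b)ᶜ = 0) :
    Tendsto (fun n => cfc (intervalCutoff a b n) T x) atTop (𝓝 x) := by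
  -- The spectral measure is known only through compactly supported test functions, so a factor κ
  -- equal to 1 on the spectrum is inserted; it also dominates the integrands.
  obtain ⟨κ, hκ1, -, hκc, hκ01⟩ := exists_continuous_one_zero_of_isCompact
    (ContinuousFunctionalCalculus.isCompact_spectrum (R := ℝ) T) isClosed_empty
    (Set.disjoint_empty _)
  have hcc : ∀ n, Continuous fun l => κ l * (1 - intervalCutoff a b n l) ^ 2 := fun n => by
    have := continuous_intervalCutoff a b n
    fun_prop
  have hF : ∀ n, ∫ l, κ l * (1 - intervalCutoff a b n l) ^ 2 ∂spectralMeasure T x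
      = ‖x - cfc (intervalCutoff a b n) T x‖ ^ 2 := by
    intro n
    have e0 := integral_spectralMeasure T x
      ⟨⟨fun l => κ l * (1 - intervalCutoff a b n l) ^ 2, hcc n⟩, hκc.mul_right⟩
    refine e0.trans ?_
    rw [← norm_sub_cfc_sq hT (continuous_intervalCutoff a b n)]
    congr 3
    refine cfc_congr fun l hl => ?_
    show κ l * (1 - intervalCutoff a b n l) ^ 2 = _
    rw [hκ1 hl, Pi.one_apply, one_mul, pow_two]
  have hreg : (spectralMeasure T x).Regular := RealRMK.regular_rieszMeasure _
  generalize spectralMeasure T x = ν at hx hF hreg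
  have hlim : Tendsto (fun n => ∫ l, κ l * (1 - intervalCutoff a b n l) ^ 2 ∂ν) atTop
      (𝓝 (∫ _, (0 : ℝ) ∂ν)) := by
    refine tendsto_integral_of_dominated_convergence κ
      (fun n => (hcc n).aestronglyMeasurable)
      (κ.continuous.integrable_of_hasCompactSupport hκc) (fun n => ae_of_all _ fun l => ?_) ?_
    · obtain ⟨h1, h2⟩ := intervalCutoff_mem_Icc a b n l
      rw [Real.norm_eq_abs, abs_of_nonneg (mul_nonneg (hκ01 l).1 (sq_nonneg _))]
      exact mul_le_of_le_one_right (hκ01 l).1 (pow_le_one₀ (by linarith) (by linarith))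
    · have : ∀ᵐ l ∂ν, l ∈ Set.Ioo a b := hx
      filter_upwards [this] with l hl
      refine tendsto_const_nhds.congr' ?_
      filter_upwards [intervalCutoff_eventually_eq_one hl] with n hn
      simp [hn]
  simp only [hF, integral_zero] at hlim
  have h2 := hlim.sqrt
  simp only [Real.sqrt_sq (norm_nonneg _), Real.sqrt_zero] at h2
  rw [tendsto_iff_norm_sub_tendsto_zero]
  simpa only [norm_sub_rev] using h2

/-- If `E((a, b)) v ≠ 0` then `g(T) v ≠ 0` for some continuous `g` vanishing off `(a, b)`. -/
theorem exists_operatorFunction_apply_ne_zero {T : H →L[ℂ] H} (hT : IsSelfAdjoint T) {a b : ℝ} {v : H}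
    (hv : spectralProjection T (Set.Ioo a b) v ≠ 0) :
    ∃ g : ℝ → ℝ, Continuous g ∧ (∀ l, l ∉ Set.Ioo a b → g l = 0) ∧
      operatorFunction g T v ≠ 0 := by
  unfold operatorFunction
  by_contra! hcon
  refine hv ?_
  have : CompleteSpace (spectralSubspace T (Set.Ioo a b)) :=
    (Submodule.isClosed_topologicalClosure _).completeSpace_coe
  refine (Submodule.starProjection_apply_eq_zero_iff (spectralSubspace T (Set.Ioo a b))).2 ?_
  rw [spectralSubspace, Submodule.orthogonal_closure, Submodule.mem_orthogonal]
  intro u hu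
  induction hu using Submodule.span_induction with
  | mem x hx =>
    -- ⟨x, v⟩ is the limit of ⟨χ_n(T)x, v⟩ = ⟨x, χ_n(T)v⟩, which vanishes by assumption.
    have h1 := (tendsto_cfc_intervalCutoff hT hx).inner (𝕜 := ℂ) (tendsto_const_nhds (x := v))
    refine tendsto_nhds_unique h1 (tendsto_const_nhds.congr fun n => ?_)
    rw [inner_cfc_left, hcon _ (continuous_intervalCutoff a b n)
      (fun l hl => intervalCutoff_eq_zero n hl), inner_zero_right]
  | zero => simp
  | add x y _ _ hx hy => rw [inner_add_left, hx, hy, add_zero]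
  | smul c x _ hx => rw [inner_smul_left, hx, mul_zero]

/-! ### Linear flow, concentration and weak convergence. -/

/-- The solution of the linear equation `u' = f(T) u` is `exp (t f)(T) u 0`. -/
theorem eq_operatorFunction_exp_of_hasDerivWithinAt {T : H →L[ℂ] H} (hT : IsSelfAdjoint T) {f : ℝ → ℝ}
    (hf : Continuous f) {u : ℝ → H}
    (hu : ∀ t, 0 ≤ t → HasDerivWithinAt u (operatorFunction f T (u t)) (Set.Ici 0) t) {t : ℝ}
    (ht : 0 ≤ t) : u t = operatorFunction (fun l => Real.exp (t * f l)) T (u 0) := by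
  unfold operatorFunction at *
  set A := cfc f T with hA
  have hexp : ∀ s : ℝ, NormedSpace.exp (s • A) = cfc (fun l => Real.exp (s * f l)) T := by
    intro s
    rw [hA, ← cfc_const_mul s f T hf.continuousOn, ← CFC.real_exp_eq_normedSpace_exp,
      ← cfc_comp' Real.exp (fun l => s * f l) T (by fun_prop) (by fun_prop) hT]
  have hder : ∀ s : ℝ, HasDerivAt (fun r : ℝ => NormedSpace.exp (r • A) (u 0))
      (A (NormedSpace.exp (s • A) (u 0))) s := fun s =>
    (((ContinuousLinearMap.apply ℂ H (u 0)).restrictScalars ℝ).hasFDerivAt.comp_hasDerivAt s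
      (hasDerivAt_exp_smul_const' (𝕂 := ℝ) A s))
  have := ODE_solution_unique_of_mem_Icc_right (a := 0) (b := t) (s := fun _ => Set.univ)
    (v := fun _ x => A x) (K := ‖A‖₊) (f := u) (g := fun r : ℝ => NormedSpace.exp (r • A) (u 0))
    (fun _ _ => A.lipschitz.lipschitzOnWith)
    (fun s hs => ((hu s hs.1).continuousWithinAt).mono Set.Icc_subset_Ici_self)
    (fun s hs => (hu s hs.1).mono (Set.Ici_subset_Ici.2 hs.1)) (fun _ _ => trivial)
    (fun s hs => (hder s).continuousAt.continuousWithinAt)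
    (fun s hs => (hder s).hasDerivWithinAt) (fun _ _ => trivial) (by simp)
    (Set.right_mem_Icc.2 ht)
  rw [← hexp]
  exact this

/-- Bounded approximate eigenvectors of a self-adjoint operator without eigenvectors converge
weakly to zero. -/
theorem tendsto_inner_zero_of_approximate_eigenvector {T : H →L[ℂ] H} (hT : IsSelfAdjoint T)
    {l₀ : ℝ} (hker : ∀ x, T x = (l₀ : ℂ) • x → x = 0) {w : ℝ → H} (hw : ∀ t, ‖w t‖ ≤ 1)
    (hlim : Tendsto (fun t => ‖T (w t) - (l₀ : ℂ) • w t‖) atTop (𝓝 0)) (φ : H) :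
    Tendsto (fun t => inner ℂ (w t) φ) atTop (𝓝 0) := by
  set A : H →L[ℂ] H := T - (l₀ : ℂ) • 1 with hA
  have hAsa : IsSelfAdjoint A :=
    hT.sub (IsSelfAdjoint.smul (by simp [isSelfAdjoint_iff]) (IsSelfAdjoint.one _))
  have hAx : ∀ x, A x = T x - (l₀ : ℂ) • x := fun x => rfl
  have hdense : φ ∈ A.range.topologicalClosure := by
    -- The orthogonal complement of the range of a self-adjoint operator is its kernel, here
    -- trivial.
    have h : A.range.topologicalClosure = ⊤ := by
      rw [Submodule.topologicalClosure_eq_top_iff, ContinuousLinearMap.orthogonal_range,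
        hAsa.adjoint_eq, Submodule.eq_bot_iff]
      intro x hx
      exact hker x (sub_eq_zero.1 hx)
    rw [h]; trivial
  have hφ : φ ∈ closure (A.range : Set H) := hdense
  rw [Metric.tendsto_atTop']
  intro ε hε
  obtain ⟨_, ⟨χ, rfl⟩, hχ⟩ := Metric.mem_closure_iff.1 hφ (ε / 2) (by positivity)
  have h1 : Tendsto (fun t => ‖A (w t)‖ * ‖χ‖) atTop (𝓝 0) := by
    simpa only [hAx, zero_mul] using hlim.mul_const ‖χ‖
  obtain ⟨N, hN⟩ := (Metric.tendsto_atTop'.1 h1) (ε / 2) (by positivity)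
  refine ⟨N, fun t ht => ?_⟩
  have h2 := hN t ht
  rw [Real.dist_0_eq_abs, abs_of_nonneg (by positivity)] at h2
  rw [dist_zero_right]
  have h3 : inner ℂ (w t) φ = inner ℂ (w t) (φ - A χ) + inner ℂ (A (w t)) χ := by
    have := (ContinuousLinearMap.isSelfAdjoint_iff_isSymmetric.1 hAsa) (w t) χ
    simp only [ContinuousLinearMap.coe_coe] at this
    rw [this, inner_sub_right]; ring
  have h4 : ‖(inner ℂ (w t) (φ - A χ) : ℂ)‖ < ε / 2 := by
    refine (norm_inner_le_norm _ _).trans_lt (lt_of_le_of_lt ?_ (dist_eq_norm φ (A χ) ▸ hχ))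
    exact mul_le_of_le_one_left (norm_nonneg _) (hw t)
  rw [h3]
  calc _ ≤ _ := norm_add_le _ _
    _ < ε / 2 + ε / 2 := add_lt_add h4 ((norm_inner_le_norm _ _).trans_lt h2)
    _ = ε := by ring

/-- If `f` has a strict maximum over a compact set containing the spectrum at `l₀`, and `v`
has spectral mass near `l₀`, then `exp (t f)(T) v` concentrates spectrally at `l₀`. -/
theorem tendsto_operatorFunction_exp_concentration {T : H →L[ℂ] H} (hT : IsSelfAdjoint T) {S : Set ℝ}
    (hS : IsCompact S) (hTS : spectrum ℝ T ⊆ S) {f : ℝ → ℝ} (hf : Continuous f) {l₀ : ℝ}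
    (hmax : ∀ l ∈ S, l ≠ l₀ → f l < f l₀) {v : H}
    (hv : ∀ ε > 0, ∃ g : ℝ → ℝ, Continuous g ∧ (∀ l, l ∉ Set.Ioo (l₀ - ε) (l₀ + ε) → g l = 0) ∧
      operatorFunction g T v ≠ 0) :
    (∀ t, operatorFunction (fun l => Real.exp (t * f l)) T v ≠ 0) ∧
    Tendsto (fun t => ‖T (operatorFunction (fun l => Real.exp (t * f l)) T v) -
      (l₀ : ℂ) • operatorFunction (fun l => Real.exp (t * f l)) T v‖ /
        ‖operatorFunction (fun l => Real.exp (t * f l)) T v‖) atTop (𝓝 0) := by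
  unfold operatorFunction at *
  set u : ℝ → H := fun t => cfc (fun l => Real.exp (t * f l)) T v with hu
  have hce : ∀ t, Continuous fun l => Real.exp (t * f l) := fun t => by fun_prop
  -- Running the flow backwards recovers g(T)v from u(t). This shows u(t) ≠ 0 and, for g supported
  -- near l₀, bounds ‖u(t)‖ from below.
  have hback : ∀ {g : ℝ → ℝ}, Continuous g → ∀ t,
      cfc g T v = cfc (fun l => g l * Real.exp (-(t * f l))) T (u t) := by
    intro g hg t
    rw [hu, ← cfc_mul_apply (by fun_prop) (by fun_prop)]
    congr 2
    funext l
    rw [mul_assoc, ← Real.exp_add, neg_add_cancel, Real.exp_zero, mul_one]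
  have hne : ∀ t, u t ≠ 0 := by
    intro t h0
    obtain ⟨g, hg, -, hgv⟩ := hv 1 one_pos
    exact hgv (by rw [hback hg t, h0, map_zero])
  refine ⟨hne, ?_⟩
  rw [Metric.tendsto_atTop']
  intro δ' hδ'
  obtain ⟨δ, hδ, hδδ'⟩ := exists_between hδ'
  -- Far modes lose 2η in growth rate while modes near l₀ lose less than η, leaving a relative decay
  -- exp(-tη).
  obtain ⟨η, hη, hfar⟩ : ∃ η > 0, ∀ l ∈ S, δ ≤ |l - l₀| → f l ≤ f l₀ - 2 * η := by
    have hcomp : IsCompact (S ∩ {l | δ ≤ |l - l₀|}) :=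
      hS.inter_right (isClosed_le continuous_const (by fun_prop))
    rcases (S ∩ {l | δ ≤ |l - l₀|}).eq_empty_or_nonempty with he | hne
    · exact ⟨1, one_pos, fun l hl h => absurd (show l ∈ S ∩ {l | δ ≤ |l - l₀|} from ⟨hl, h⟩)
        (by simp [he])⟩
    · obtain ⟨l₁, ⟨hl₁, hl₁'⟩, hl₁max⟩ := hcomp.exists_isMaxOn hne hf.continuousOn
      have hlt : f l₁ < f l₀ := hmax l₁ hl₁ (by
        rintro rfl
        simp only [Set.mem_ofPred_eq, sub_self, abs_zero] at hl₁'
        linarith)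
      refine ⟨(f l₀ - f l₁) / 2, by linarith, fun l hl h => ?_⟩
      have : f l ≤ f l₁ := hl₁max ⟨hl, h⟩
      linarith
  obtain ⟨ε, hε, hnear⟩ : ∃ ε > 0, ∀ l ∈ Set.Ioo (l₀ - ε) (l₀ + ε), f l₀ - η < f l := by
    obtain ⟨ε, hε, h⟩ := Metric.continuous_iff.1 hf l₀ η hη
    refine ⟨ε, hε, fun l hl => ?_⟩
    have := h l (by rw [Real.dist_eq, abs_lt]; constructor <;> linarith [hl.1, hl.2])
    rw [Real.dist_eq, abs_lt] at this
    linarith [this.1]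
  obtain ⟨g, hg, hg0, hgv⟩ := hv ε hε
  obtain ⟨B, hB⟩ := hS.exists_bound_of_continuousOn hg.continuousOn
  obtain ⟨D, hD⟩ := hS.exists_bound_of_continuousOn
    (f := fun l : ℝ => l - l₀) (by fun_prop)
  set B' := max B 1
  set D' := max D 0
  have hB' : 0 < B' := lt_max_of_lt_right one_pos
  have hgv' : 0 < ‖cfc g T v‖ := norm_pos_iff.2 hgv
  have hlower : ∀ t, 0 ≤ t → ‖cfc g T v‖ * Real.exp (t * (f l₀ - η)) ≤ B' * ‖u t‖ := by
    intro t ht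
    have h1 : ‖cfc g T v‖ ≤ B' * Real.exp (-(t * (f l₀ - η))) * ‖u t‖ := by
      rw [hback hg t]
      refine cfc_apply_norm_le (by positivity) (fun l hl => ?_) _
      by_cases hlI : l ∈ Set.Ioo (l₀ - ε) (l₀ + ε)
      · rw [abs_mul, Real.abs_exp]
        refine mul_le_mul ((hB l (hTS hl)).trans (le_max_left _ _)) ?_ (Real.exp_pos _).le hB'.le
        rw [Real.exp_le_exp, neg_le_neg_iff]
        exact mul_le_mul_of_nonneg_left (hnear l hlI).le ht
      · rw [hg0 l hlI, zero_mul, abs_zero]; positivity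
    calc _ ≤ B' * Real.exp (-(t * (f l₀ - η))) * ‖u t‖ * Real.exp (t * (f l₀ - η)) :=
          mul_le_mul_of_nonneg_right h1 (Real.exp_pos _).le
      _ = B' * ‖u t‖ * (Real.exp (-(t * (f l₀ - η))) * Real.exp (t * (f l₀ - η))) := by ring
      _ = B' * ‖u t‖ := by rw [← Real.exp_add, neg_add_cancel, Real.exp_zero, mul_one]
  have hupper : ∀ t, 0 ≤ t → ‖T (u t) - (l₀ : ℂ) • u t‖
      ≤ δ * ‖u t‖ + D' * Real.exp (t * (f l₀ - 2 * η)) * ‖v‖ := by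
    intro t ht
    -- Truncating l - l₀ to [-δ, δ] costs at most δ‖u(t)‖; the remainder vanishes for |l - l₀| < δ
    -- and so sees only the far modes.
    set c : ℝ → ℝ := fun l => max (-δ) (min δ (l - l₀)) with hc
    have hcc : Continuous c := by fun_prop
    have hsplit : T (u t) - (l₀ : ℂ) • u t = cfc c T (u t) +
        cfc (fun l => ((l - l₀) - c l) * Real.exp (t * f l)) T v := by
      rw [cfc_mul_apply (by fun_prop) (hce t), cfc_sub _ _ T (by fun_prop) hcc.continuousOn,
        _root_.sub_apply, add_sub_cancel, cfc_sub _ _ T (by fun_prop) (by fun_prop),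
        cfc_const l₀ T hT, cfc_id' ℝ T hT]
      simp [Algebra.algebraMap_eq_smul_one, hu]
    rw [hsplit]
    refine (norm_add_le _ _).trans (add_le_add ?_ ?_)
    · refine cfc_apply_norm_le hδ.le (fun l _ => ?_) _
      rw [abs_le]
      exact ⟨le_max_left _ _, max_le (by linarith) (min_le_left _ _)⟩
    · refine cfc_apply_norm_le (by positivity) (fun l hl => ?_) _
      rw [abs_mul, Real.abs_exp]
      rcases le_or_gt δ |l - l₀| with h | h
      · refine mul_le_mul (le_trans ?_ ((hD l (hTS hl)).trans (le_max_left _ _))) ?_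
          (Real.exp_pos _).le (le_max_right _ _)
        · rw [Real.norm_eq_abs]
          simp only [hc]
          rcases le_abs.1 h with h' | h'
          · rw [min_eq_left h', max_eq_right (by linarith), abs_of_nonneg, abs_of_nonneg] <;>
              linarith
          · rw [min_eq_right (by linarith), max_eq_left (by linarith), abs_of_nonpos,
              abs_of_nonpos] <;> linarith
        · rw [Real.exp_le_exp]
          exact mul_le_mul_of_nonneg_left (hfar l (hTS hl) h) ht
      · rw [abs_lt] at h
        have : c l = l - l₀ := by
          simp only [hc]
          rw [min_eq_right h.2.le, max_eq_right h.1.le]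
        rw [this, sub_self, abs_zero, zero_mul]
        positivity
  set κ : ℝ := D' * ‖v‖ * B' / ‖cfc g T v‖ with hκ
  have hbound : ∀ t, 0 ≤ t → ‖T (u t) - (l₀ : ℂ) • u t‖ / ‖u t‖ ≤ δ + κ * Real.exp (-(t * η)) := by
    intro t ht
    have hut : 0 < ‖u t‖ := norm_pos_iff.2 (hne t)
    rw [div_le_iff₀ hut, add_mul]
    refine (hupper t ht).trans (add_le_add le_rfl (by
      have h1 := (div_le_iff₀' hB').2 (hlower t ht)
      have e : Real.exp (t * (f l₀ - 2 * η))
          = Real.exp (-(t * η)) * Real.exp (t * (f l₀ - η)) := by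
        rw [← Real.exp_add]; congr 1; ring
      have hκ0 : 0 ≤ κ := by positivity
      calc _ = κ * Real.exp (-(t * η)) *
            (‖cfc g T v‖ * Real.exp (t * (f l₀ - η)) / B') := by
            rw [e, hκ]; field_simp
        _ ≤ κ * Real.exp (-(t * η)) * ‖u t‖ := by gcongr))
  have hlim : Tendsto (fun t => δ + κ * Real.exp (-(t * η))) atTop (𝓝 (δ + κ * 0)) :=
    tendsto_const_nhds.add ((Real.tendsto_exp_neg_atTop_nhds_zero.comp
      (tendsto_id.atTop_mul_const hη)).const_mul κ)
  rw [mul_zero, add_zero] at hlim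
  obtain ⟨N, hN⟩ := (((hlim.eventually_lt_const hδδ').and (eventually_ge_atTop 0))).exists_forall_of_atTop
  refine ⟨N, fun t ht => ?_⟩
  obtain ⟨h1, h2⟩ := hN t ht.le
  rw [Real.dist_0_eq_abs, abs_of_nonneg (by positivity)]
  exact (hbound t h2).trans_lt h1

theorem operatorFunction_affine_sub_apply {T : H →L[ℂ] H} (hT : IsSelfAdjoint T) {f : ℝ → ℝ}
    (hf : Continuous f) (a c k : ℝ) (x : H) :
    operatorFunction (fun l => (a + c * l) - k * f l) T x
      = a • x + c • T x - k • operatorFunction f T x := by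
  unfold operatorFunction
  rw [cfc_sub _ _ T (by fun_prop) (by fun_prop),
    cfc_const_add a (fun l => c * l) T (by fun_prop) hT, cfc_const_mul_id c T hT,
    cfc_const_mul k f T hf.continuousOn]
  simp [Algebra.algebraMap_eq_smul_one]

theorem IsSelfAdjoint.spectrum_subset_Icc_spectralRadius {T : H →L[ℂ] H} (hT : IsSelfAdjoint T) :
    spectrum ℝ T ⊆ Set.Icc (-(spectralRadius ℂ T).toReal) (spectralRadius ℂ T).toReal := by
  intro l hl
  have h1 := spectrum.norm_le_norm_mul_of_mem hl
  -- Only an inequality, since H may be trivial.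
  have h2 : ‖(1 : H →L[ℂ] H)‖ ≤ 1 := ContinuousLinearMap.norm_id_le
  rw [hT.toReal_spectralRadius_complex_eq_norm]
  exact abs_le.1 (h1.trans (mul_le_of_le_one_right (norm_nonneg _) h2))

end FunctionalCalculus

/-! ### Reduction to L²₀ and the closed-loop equation. -/

theorem integral_constL2 (z : ℂ) : ∫ x, constL2 z x ∂torusMeasure = z := by
  have h2 : (constL2 z : L2Torus) =ᵐ[torusMeasure] Function.const _ z := Lp.coeFn_const ..
  rw [integral_congr_ae h2]
  simp

theorem inner_constL2 (z : ℂ) (f : L2Torus) :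
    inner ℂ (constL2 z) f = (starRingEnd ℂ) z * ∫ x, f x ∂torusMeasure := by
  have h2 : (constL2 z : L2Torus) =ᵐ[torusMeasure] Function.const _ z := Lp.coeFn_const ..
  rw [L2.inner_def, ← integral_const_mul]
  refine integral_congr_ae ?_
  filter_upwards [h2] with x hx
  rw [hx]
  simp [mul_comm]

theorem deviation_mem_L2Zero (m : ℝ → L2Torus) (t : ℝ) : deviation m t ∈ L2Zero := by
  rw [Submodule.mem_orthogonal]
  intro u hu
  induction hu using Submodule.span_induction with
  | mem x hx =>
    obtain ⟨z, rfl⟩ := hx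
    rw [deviation, inner_sub_right, inner_constL2, inner_constL2, integral_constL2, sub_self]
  | zero => simp
  | add x y _ _ hx hy => rw [inner_add_left, hx, hy, add_zero]
  | smul c x _ hx => rw [inner_smul_left, hx, mul_zero]

theorem coe_orthogonalProjectionOnto_L2Zero (m : ℝ → L2Torus) (t : ℝ) :
    (L2Zero.orthogonalProjectionOnto (m t) : L2Torus) = deviation m t := by
  refine Submodule.eq_starProjection_of_mem_of_inner_eq_zero (deviation_mem_L2Zero m t)
    fun w hw => ?_
  rw [deviation, sub_sub_cancel]
  exact (Submodule.mem_orthogonal _ _).1 hw _ (Submodule.subset_span ⟨_, rfl⟩)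

theorem graphexonOpZero_isSelfAdjoint : IsSelfAdjoint graphexonOpZero := by
  rw [ContinuousLinearMap.isSelfAdjoint_iff_isSymmetric]
  intro x y
  exact (ContinuousLinearMap.isSelfAdjoint_iff_isSymmetric.1 graphexonOp_isSelfAdjoint) x y

/-- Since 𝒢 is symmetric and preserves L²₀, it maps the orthogonal complement of L²₀ into itself.
This intertwining lets the mean field equation be projected to L²₀. -/
theorem graphexonOpZero_orthogonalProjectionOnto (f : L2Torus) :
    graphexonOpZero (L2Zero.orthogonalProjectionOnto f) =
      L2Zero.orthogonalProjectionOnto (graphexonOp f) := by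
  apply Subtype.ext
  refine (Submodule.eq_starProjection_of_mem_of_inner_eq_zero (Subtype.prop _)
    fun w hw => ?_).symm
  have h1 := (ContinuousLinearMap.isSelfAdjoint_iff_isSymmetric.1 graphexonOp_isSelfAdjoint)
    (f - L2Zero.starProjection f) w
  simp only [ContinuousLinearMap.coe_coe, map_sub] at h1
  refine h1.trans (Submodule.starProjection_inner_eq_zero f _ ?_)
  exact graphexonOp_mem_L2Zero ⟨w, hw⟩

theorem spectrum_graphexonOpZero_subset : spectrum ℝ graphexonOpZero ⊆ sigmaZero :=
  graphexonOpZero_isSelfAdjoint.spectrum_subset_Icc_spectralRadius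

theorem eq_zero_of_graphexonOpZero_eq_smul {l : ℝ} (f : L2Zero)
    (h : graphexonOpZero f = (l : ℂ) • f) : f = 0 :=
  Subtype.ext (eq_zero_of_graphexonOp_eq_smul f.2 (congrArg Subtype.val h))

theorem operatorFunction_graphexonOp_coe {g : ℝ → ℝ} (hg : Continuous g) (f : L2Zero) :
    operatorFunction g graphexonOp (f : L2Torus) = operatorFunction g graphexonOpZero f :=
  operatorFunction_intertwine graphexonOp_isSelfAdjoint graphexonOpZero_isSelfAdjoint L2Zero.subtypeL
    (fun _ => rfl) hg f

namespace LQGParameters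

variable (θ : LQGParameters)

theorem k_ne_zero : θ.k ≠ 0 := div_ne_zero (pow_ne_zero 2 θ.b_ne) θ.r_pos.ne'

theorem continuous_disc : Continuous θ.disc := by unfold disc; fun_prop

theorem continuous_p : Continuous θ.p := by
  have := θ.continuous_disc
  unfold p
  fun_prop

theorem continuous_Acl : Continuous θ.Acl := by
  have := θ.continuous_disc
  unfold Acl
  fun_prop

theorem Acl_eq (l : ℝ) : θ.Acl l = θ.ac + θ.c * l - θ.k * θ.p l := by
  have := θ.k_ne_zero
  rw [Acl, p, aγ]
  field_simp
  ring

theorem operatorFunction_Acl_apply (f : L2Torus) :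
    operatorFunction θ.Acl graphexonOp f
      = θ.ac • f + θ.c • graphexonOp f - θ.k • θ.decoupling f := by
  rw [show θ.Acl = fun l => (θ.ac + θ.c * l) - θ.k * θ.p l from funext θ.Acl_eq]
  exact operatorFunction_affine_sub_apply graphexonOp_isSelfAdjoint θ.continuous_p _ _ _ f

variable {θ}

theorem IsDominantMode.Acl_lt {l₀ : ℝ} (h : θ.IsDominantMode l₀) {l : ℝ} (hl : l ∈ sigmaZero)
    (hne : l ≠ l₀) : θ.Acl l < θ.Acl l₀ := by
  have hle : θ.Acl l ≤ θ.μmax :=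
    le_csSup (isCompact_Icc.image θ.continuous_Acl).bddAbove ⟨l, hl, rfl⟩
  rw [h.2.1]
  exact lt_of_le_of_ne hle fun he => hne (h.2.2 l hl he)

/-- Apply the projection to the equation for m: it intertwines 𝒜_cl(𝒢) with its restriction, so the
projected field solves an autonomous linear equation on L²₀. -/
theorem IsClosedLoopMeanState.orthogonalProjectionOnto_eq {m : ℝ → L2Torus}
    (hm : θ.IsClosedLoopMeanState m) {t : ℝ} (ht : 0 ≤ t) :
    L2Zero.orthogonalProjectionOnto (m t) = operatorFunction (fun l => Real.exp (t * θ.Acl l)) graphexonOpZero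
      (L2Zero.orthogonalProjectionOnto (m 0)) := by
  refine eq_operatorFunction_exp_of_hasDerivWithinAt graphexonOpZero_isSelfAdjoint θ.continuous_Acl
    (u := fun t => L2Zero.orthogonalProjectionOnto (m t)) (fun s hs => ?_) ht
  have h1 := (L2Zero.orthogonalProjectionOnto.restrictScalars ℝ).hasFDerivAt.comp_hasDerivWithinAt s
    (hm s hs)
  rw [← operatorFunction_Acl_apply] at h1
  simp only [operatorFunction_intertwine graphexonOpZero_isSelfAdjoint graphexonOp_isSelfAdjoint
    L2Zero.orthogonalProjectionOnto graphexonOpZero_orthogonalProjectionOnto θ.continuous_Acl]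
  exact h1

end LQGParameters

theorem mainTheorem10 (θ : LQGParameters)
    (hSARE : ∀ l ∈ sigmaZero ∪ {1}, ∃ p : ℝ, θ.SARE l p)
    (hTuring : θ.TuringInstability)
    (lstar : ℝ) (hlstar : θ.IsDominantMode lstar)
    (m : ℝ → L2Torus) (hm : θ.IsClosedLoopMeanState m)
    (he₀ : ∀ ε : ℝ, 0 < ε →
      0 < ‖spectralProjection graphexonOp
        (Set.Ioo (lstar - ε) (lstar + ε)) (deviation m 0)‖) :
    (∀ t : ℝ, 0 ≤ t → deviation m t ≠ 0) ∧
    (∀ φ ∈ L2Zero,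
      Tendsto (fun t : ℝ => inner ℂ (normalizedDeviation m t) φ) atTop (𝓝 0)) ∧
    ¬ ∃ f : L2Torus, Tendsto (normalizedDeviation m) atTop (𝓝 f) := by
  set v : L2Zero := L2Zero.orthogonalProjectionOnto (m 0) with hv
  set u : ℝ → L2Zero := fun t => operatorFunction (fun l => Real.exp (t * θ.Acl l)) graphexonOpZero v with hu
  have hdev : ∀ t, 0 ≤ t → deviation m t = u t := fun t ht => by
    rw [← coe_orthogonalProjectionOnto_L2Zero, hm.orthogonalProjectionOnto_eq ht]
  -- The assumption on e₀ concerns the spectral projections of 𝒢 on all of L²; continuous functions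
  -- of 𝒢 carry it to the restriction, so spectral projections need not be compared.
  have hmass : ∀ ε > 0, ∃ g : ℝ → ℝ, Continuous g ∧
      (∀ l, l ∉ Set.Ioo (lstar - ε) (lstar + ε) → g l = 0) ∧ operatorFunction g graphexonOpZero v ≠ 0 := by
    intro ε hε
    obtain ⟨g, hg, hg0, hne⟩ := exists_operatorFunction_apply_ne_zero graphexonOp_isSelfAdjoint
      (norm_pos_iff.1 (he₀ ε hε))
    refine ⟨g, hg, hg0, fun h => hne ?_⟩
    rw [← coe_orthogonalProjectionOnto_L2Zero, operatorFunction_graphexonOp_coe hg, h, Submodule.coe_zero]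
  obtain ⟨hne, hconc⟩ := tendsto_operatorFunction_exp_concentration graphexonOpZero_isSelfAdjoint
    (isCompact_Icc : IsCompact sigmaZero) spectrum_graphexonOpZero_subset θ.continuous_Acl
    (fun l hl => hlstar.Acl_lt hl) hmass
  set w : ℝ → L2Zero := fun t => (‖u t‖⁻¹ : ℝ) • u t with hw
  have hnorm : ∀ t, ‖w t‖ = 1 := fun t => by
    rw [hw, norm_smul, norm_inv, norm_norm, inv_mul_cancel₀ (norm_ne_zero_iff.2 (hne t))]
  have hwlim : Tendsto (fun t => ‖graphexonOpZero (w t) - (lstar : ℂ) • w t‖) atTop (𝓝 0) := by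
    refine hconc.congr fun t => ?_
    have : graphexonOpZero (w t) - (lstar : ℂ) • w t
        = (‖u t‖⁻¹ : ℝ) • (graphexonOpZero (u t) - (lstar : ℂ) • u t) := by
      rw [hw, smul_sub, smul_comm (lstar : ℂ) (‖u t‖⁻¹ : ℝ)]
      congr 1
      exact (graphexonOpZero.restrictScalars ℝ).map_smul _ _
    rw [this, norm_smul, norm_inv, norm_norm, div_eq_inv_mul]
  have hweak := tendsto_inner_zero_of_approximate_eigenvector graphexonOpZero_isSelfAdjoint
    (fun x => eq_zero_of_graphexonOpZero_eq_smul x) (fun t => (hnorm t).le) hwlim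
  have hnd : ∀ᶠ t in atTop, (w t : L2Torus) = normalizedDeviation m t := by
    filter_upwards [eventually_ge_atTop 0] with t ht
    rw [normalizedDeviation, hdev t ht]
    rfl
  have hinner : ∀ φ ∈ L2Zero,
      Tendsto (fun t : ℝ => inner ℂ (normalizedDeviation m t) φ) atTop (𝓝 0) := by
    intro φ hφ
    refine (hweak ⟨φ, hφ⟩).congr' ?_
    filter_upwards [hnd] with t ht
    rw [← ht]
    rfl
  refine ⟨fun t ht h0 => hne t ?_, hinner, ?_⟩
  · rw [hdev t ht] at h0
    exact Subtype.ext h0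
  · rintro ⟨f, hf⟩
    have hfw : Tendsto (fun t => (w t : L2Torus)) atTop (𝓝 f) :=
      hf.congr' (hnd.mono fun t ht => ht.symm)
    -- The limit lies in the closed subspace L²₀, so it may serve as its own test function.
    have hfmem : f ∈ L2Zero := (Submodule.isClosed_orthogonal _).mem_of_tendsto hfw
      (Eventually.of_forall fun t => (w t).2)
    have hf1 : ‖f‖ = 1 :=
      tendsto_nhds_unique hfw.norm (tendsto_const_nhds.congr fun t => (hnorm t).symm)
    have h1 := tendsto_nhds_unique (hf.inner (𝕜 := ℂ) (tendsto_const_nhds (x := f)))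
      (hinner f hfmem)
    rw [inner_self_eq_zero] at h1
    rw [h1, norm_zero] at hf1
    exact zero_ne_one hf1
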